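/- Let $\tau>0$, $T>0$, let $\lambda_0,\lambda\in L^\infty(\mathbb{R})$ be real-valued, and write $L^2=L^2(\mathbb{R})$ (real-valued functions). Let $A_{\lambda_0}v:=-v_{xxx}+v_{xx}-\lambda_0 v$ with domain $H^3(\mathbb{R})$; this operator generates a strongly continuous semigroup $(S(t))_{t\ge 0}$ in $L^2$. Let $u_0\in C([-\tau,0];L^2)$ and $f\in L^1(0,T;L^2)$. The problem $$u_t(t)+\lambda\, u(t-\tau)=A_{\lambda_0}u(t)+f(t)\ \text{ in } (0,T),\qquad u(s)=u_0(s)\ \text{ for } s\in[-\tau,0],$$ has a unique mild solution, that is, there is a unique $u\in C([-\tau,T];L^2)$ with $u=u_0$ on $[-\tau,0]$ and $$u(t)=S(t)u_0(0)-\int_0^t S(t-s)\lambda u(s-\tau)\,ds+\int_0^t S(t-s)f(s)\,ds,\qquad t\in[0,T].$$ This solution belongs to $\mathcal{B}_T:=C([0,T];L^2)\cap L^2(0,T;H^1(\mathbb{R}))$ and, with the norm $$\|u\|_{\mathcal{B}_T}=\max_{t\in[0,T]}\|u(t)\|_{L^2}+\Big(\int_0^T\|u_x(t)\|_{L^2}^2\,dt\Big)^{1/2},$$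 it satisfies the estimate $$\|u\|_{\mathcal{B}_T}\le C_T\Big\{\|u(0)\|_{L^2}+\|f\|_{L^1(0,T;L^2)}+\big(\|\lambda\|_\infty\tau^{1/2}+\|\lambda\|_\infty^{1/2}\big)\|u\|_{L^2(-\tau,0;L^2)}\Big\},$$ where $$C_T=\sqrt{\tfrac32}\,\big(1+e^{2\|\lambda\|_\infty T}\big)^{1/2}e^{(\|\lambda\|_\infty+\|\lambda_0\|_\infty)T}.$$ Moreover, for all $t\in[0,T]$, $$\frac12\|u(t)\|_{L^2}^2+\int_0^t\|u_x(s)\|_{L^2}^2\,ds+\int_0^t\!\int_{\mathbb{R}}\lambda_0(x)\,u(x,s)^2\,dx\,ds+\int_0^t\!\int_{\mathbb{R}}\lambda(x)\, u(x,s-\tau)\,u(x,s)\,dx\,ds=\frac12\|u(0)\|_{L^2}^2+\int_0^t\!\int_{\mathbb{R}}f(x,s)\,u(x,s)\,dx\,ds.$$ -/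

import Mathlib

open MeasureTheory Filter Topology Set
open scoped ENNReal ContDiff

noncomputable section

namespace KdVBurgers

/-- The real Hilbert space `L²(ℝ)`. -/
abbrev L2 : Type := Lp ℝ 2 (volume : Measure ℝ)

/-- The space `L^∞(ℝ)` of real coefficients. An element `a` acts on `v : L2` by the pointwise
product `a • v : L2`. -/
abbrev Linf : Type := Lp ℝ ∞ (volume : Measure ℝ)

/-- `w ∈ L²(ℝ)` is the weak derivative of `v ∈ L²(ℝ)`:
`∫ v φ' = - ∫ w φ` for all test functions `φ ∈ C_c^∞(ℝ)`. -/
def HasWeakDeriv (v w : L2) : Prop :=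
  ∀ φ : ℝ → ℝ, ContDiff ℝ ∞ φ → HasCompactSupport φ →
    ∫ x, v x * deriv φ x = - ∫ x, w x * φ x

/-- The Sobolev space `H^k(ℝ)`: the weak derivatives up to order `k` exist in `L²(ℝ)`. -/
def MemH : ℕ → L2 → Prop
  | 0, _ => True
  | k + 1, v => ∃ w : L2, HasWeakDeriv v w ∧ MemH k w

open Classical in
/-- The weak derivative `∂ₓ v ∈ L²(ℝ)` of `v ∈ H¹(ℝ)` (and `0` if `v ∉ H¹(ℝ)`). -/
def weakDeriv (v : L2) : L2 :=
  if h : ∃ w : L2, HasWeakDeriv v w then h.choose else 0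

theorem HasWeakDeriv.unique {v w w' : L2} (h : HasWeakDeriv v w) (h' : HasWeakDeriv v w') :
    w = w' := by
  refine Lp.ext ?_
  refine ae_eq_of_integral_contDiff_smul_eq
    ((Lp.memLp w).locallyIntegrable (by norm_num))
    ((Lp.memLp w').locallyIntegrable (by norm_num)) ?_
  intro φ hφ hc
  have e := (h φ hφ hc).symm.trans (h' φ hφ hc)
  have e' := neg_injective e
  simpa only [smul_eq_mul, mul_comm] using e'

theorem HasWeakDeriv.weakDeriv_eq {v w : L2} (h : HasWeakDeriv v w) : weakDeriv v = w := by
  have hex : ∃ w : L2, HasWeakDeriv v w := ⟨w, h⟩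
  rw [weakDeriv, dif_pos hex]
  exact hex.choose_spec.unique h

/-- The operator `A v = - v_xxx + v_xx - lam0 v`, to be used on its domain `H³(ℝ)`. -/
def kdvbOperator (lam0 : Linf) (v : L2) : L2 :=
  - weakDeriv (weakDeriv (weakDeriv v)) + weakDeriv (weakDeriv v) - (lam0 • v : L2)

/-- `(S t)_{t ≥ 0}` is a strongly continuous semigroup of bounded operators on `L²(ℝ)`.
The values of `S` at negative times are irrelevant. -/
structure IsC0Semigroup (S : ℝ → L2 →L[ℝ] L2) : Prop where
  zero : S 0 = ContinuousLinearMap.id ℝ L2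
  add : ∀ s t : ℝ, 0 ≤ s → 0 ≤ t → S (s + t) = (S s).comp (S t)
  tendsto_zero : ∀ v : L2, Tendsto (fun t => S t v) (𝓝[>] 0) (𝓝 v)

/-- `S` is the strongly continuous semigroup on `L²(ℝ)` whose infinitesimal generator is
`A v = - v_xxx + v_xx - lam0 v` with domain exactly `H³(ℝ)`. -/
structure IsKdVBSemigroup (lam0 : Linf) (S : ℝ → L2 →L[ℝ] L2) : Prop
    extends IsC0Semigroup S where
  generator : ∀ v w : L2,
    Tendsto (fun t : ℝ => t⁻¹ • (S t v - v)) (𝓝[>] 0) (𝓝 w) ↔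
      MemH 3 v ∧ kdvbOperator lam0 v = w

/-- `u ∈ C([-τ, T]; L²(ℝ))` is a mild solution of
`u_t(t) + lam u(t - τ) = A u(t) + f(t)` on `(0, T)`, `u = u₀` on `[-τ, 0]`,
where `S` is the semigroup generated by `A`. -/
structure IsMildSolution (S : ℝ → L2 →L[ℝ] L2) (lam : Linf) (τ T : ℝ)
    (u₀ f u : ℝ → L2) : Prop where
  continuousOn : ContinuousOn u (Icc (-τ) T)
  history : ∀ s ∈ Icc (-τ) 0, u s = u₀ s
  formula : ∀ t ∈ Icc 0 T,
    u t = S t (u₀ 0) - (∫ s in 0..t, S (t - s) (lam • u (s - τ) : L2))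
      + ∫ s in 0..t, S (t - s) (f s)

/-- `u ∈ L²(0, T; H¹(ℝ))`. -/
structure MemL2H1 (T : ℝ) (u : ℝ → L2) : Prop where
  ae_memH : ∀ᵐ t ∂(volume.restrict (Ioo 0 T)), MemH 1 (u t)
  memLp : MemLp u 2 (volume.restrict (Ioo 0 T))
  memLp_weakDeriv : MemLp (fun t => weakDeriv (u t)) 2 (volume.restrict (Ioo 0 T))

/-- `u` belongs to `𝓑_T = C([0, T]; L²(ℝ)) ∩ L²(0, T; H¹(ℝ))`. -/
def MemB (T : ℝ) (u : ℝ → L2) : Prop :=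
  ContinuousOn u (Icc 0 T) ∧ MemL2H1 T u

/-- The norm `‖u‖_{C([0, T]; L²)} + ‖∂ₓ u‖_{L²(0, T; L²)}` of `𝓑_T`. -/
def normB (T : ℝ) (u : ℝ → L2) : ℝ :=
  sSup ((fun t => ‖u t‖) '' Icc 0 T) + √(∫ t in 0..T, ‖weakDeriv (u t)‖ ^ 2)

/-- The constant
`C_T = √(3/2) (1 + e^{2 ‖lam‖_∞ T})^{1/2} e^{(‖lam‖_∞ + ‖lam0‖_∞) T}`. -/
def constC (lam0 lam : Linf) (T : ℝ) : ℝ :=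
  √(3 / 2) * √(1 + Real.exp (2 * ‖lam‖ * T)) * Real.exp ((‖lam‖ + ‖lam0‖) * T)

end KdVBurgers

end

/-! Generation. The weak derivative ∂ on real L² is skew-adjoint: a vector orthogonal to the range
of a + ∂ on test functions solves z' = a z weakly, so it would be a multiple of e^{ax}, which is
square integrable only if it vanishes. Hence a + ∂ is onto for every real a ≠ 0, and integration by
parts holds on all of H¹. It follows that ⟨Av, v⟩ = −‖v_x‖² − ⟨λ₀v, v⟩, and that 4/27 + ∂³ − ∂² is
onto, because its symbol splits into real linear factors. A bounded perturbation brings in λ₀, and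
Yosida approximation yields the semigroup, with domain exactly H³ (`exists_isKdVBSemigroup`).

Existence and uniqueness. The delay term at time s sees only u(s − τ), so on each interval of length
τ it is a known source. Finitely many applications of Duhamel's formula determine u
(`exists_mildMap_fixed`, `IsMildSolution.eqOn`).

Energy. A mild solution need not be differentiable in time, and its values are not known in advance
to lie in H¹. The identity is therefore proved for J_n u, where J_n averages the semigroup over [0,
1/(n+1)]: J_n maps into the domain, A J_n is bounded, and J_n u is a primitive of an integrable
function. The same identity for J_n − J_m shows that ∂J_n u is Cauchy in L²(0,T;L²). This gives u ∈
L²(0,T;H¹) and lets the identity pass to the limit (`energy_identity_endpoint`).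

Estimate. Young's inequality and a shift in time bound the delay term by the history and ∫‖u‖². A
quadratic Gronwall inequality then gives ‖u(t)‖² + 2∫₀ᵗ‖u_x‖² ≤ (N e^{(‖λ‖+‖λ₀‖)T})², with N the
bracket in the claimed bound; the constant follows from 1 + 1/√2 ≤ √3 (`IsMildSolution.normB_le`).
-/

noncomputable section

namespace KdVBurgers

/-! ### Dissipative relations: resolvents, range condition, density of the domain -/

section LumerPhillips

variable {H : Type*} [NormedAddCommGroup H] [InnerProductSpace ℝ H]

/-- A linear relation `G` (the graph of an operator) is dissipative. -/
def IsDissipative (G : Submodule ℝ (H × H)) : Prop :=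
  ∀ p ∈ G, inner ℝ p.2 p.1 ≤ 0

/-- The operator `μ - G` is surjective. -/
def HasFullRange (G : Submodule ℝ (H × H)) (μ : ℝ) : Prop :=
  ∀ v, ∃ p ∈ G, μ • p.1 - p.2 = v

/-- Pair μ p.1 − p.2 with p.1 and cancel one factor ‖p.1‖. This yields both the injectivity of μ − G
and the resolvent bound 1/μ. -/
theorem IsDissipative.mul_norm_le {G : Submodule ℝ (H × H)} (hG : IsDissipative G) {μ : ℝ}
    {p : H × H} (hp : p ∈ G) : μ * ‖p.1‖ ≤ ‖μ • p.1 - p.2‖ := by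
  have h1 : inner ℝ (μ • p.1 - p.2) p.1 ≤ ‖μ • p.1 - p.2‖ * ‖p.1‖ := real_inner_le_norm _ _
  have h2 := hG p hp
  rw [inner_sub_left, real_inner_smul_left, real_inner_self_eq_norm_sq] at h1
  rcases (norm_nonneg p.1).eq_or_lt with h | h
  · rw [← h]; simp
  · nlinarith

theorem IsDissipative.exists_resolvent {G : Submodule ℝ (H × H)} (hG : IsDissipative G) {μ : ℝ}
    (hμ : 0 < μ) (hr : HasFullRange G μ) :
    ∃ R : H →L[ℝ] H, ‖R‖ ≤ μ⁻¹ ∧ (∀ v, (R v, μ • R v - v) ∈ G) ∧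
      ∀ p ∈ G, R (μ • p.1 - p.2) = p.1 := by
  choose q hq hqv using hr
  have huniq : ∀ p ∈ G, ∀ p' ∈ G, μ • p.1 - p.2 = μ • p'.1 - p'.2 → p.1 = p'.1 := by
    intro p hp p' hp' h
    have := hG.mul_norm_le (μ := μ) (G.sub_mem hp hp')
    have h0 : μ • (p - p').1 - (p - p').2 = 0 := by
      simp only [Prod.fst_sub, Prod.snd_sub, smul_sub]
      rw [← sub_eq_zero] at h
      rw [← h]; abel
    rw [h0, norm_zero] at this
    have h3 : ‖(p - p').1‖ = 0 := le_antisymm (by nlinarith [norm_nonneg (p - p').1]) (norm_nonneg _)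
    rw [norm_eq_zero] at h3
    exact sub_eq_zero.1 h3
  let L : H →ₗ[ℝ] H :=
    { toFun := fun v => (q v).1
      map_add' := fun v w => by
        refine huniq _ (hq _) (q v + q w) (G.add_mem (hq v) (hq w)) ?_
        rw [hqv]
        conv_lhs => rw [← hqv v, ← hqv w]
        simp only [Prod.fst_add, Prod.snd_add, smul_add]; abel
      map_smul' := fun c v => by
        refine huniq _ (hq _) (c • q v) (G.smul_mem c (hq v)) ?_
        rw [hqv]
        conv_lhs => rw [← hqv v]
        simp only [Prod.smul_fst, Prod.smul_snd, smul_sub, smul_comm c μ] }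
  have hL : ∀ v, ‖L v‖ ≤ μ⁻¹ * ‖v‖ := fun v => by
    have := hG.mul_norm_le (μ := μ) (hq v)
    rw [hqv] at this
    rw [inv_mul_eq_div, le_div_iff₀ hμ, mul_comm]
    exact this
  refine ⟨L.mkContinuous μ⁻¹ hL, L.mkContinuous_norm_le (by positivity) _, fun v => ?_,
    fun p hp => ?_⟩
  · have : μ • (q v).1 - v = (q v).2 := by
      rw [sub_eq_iff_eq_add, add_comm, ← sub_eq_iff_eq_add, hqv]
    change ((q v).1, μ • (q v).1 - v) ∈ G
    rw [this]
    exact hq v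
  · exact huniq _ (hq _) p hp (hqv _)

/-- With R the resolvent at μ, μ − G − C = (1 − CR)(μ − G), and ‖CR‖ ≤ ‖C‖/μ < 1 makes the first
factor invertible. -/
theorem IsDissipative.exists_of_perturbation [CompleteSpace H] {G : Submodule ℝ (H × H)}
    (hG : IsDissipative G) {μ : ℝ} (hμ : 0 < μ) (hr : HasFullRange G μ) (C : H →L[ℝ] H)
    (hC : ‖C‖ < μ) (v : H) : ∃ p ∈ G, μ • p.1 - p.2 - C p.1 = v := by
  obtain ⟨R, hR, hRG, -⟩ := hG.exists_resolvent hμ hr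
  have hlt : ‖C * R‖ < 1 := by
    refine (norm_mul_le _ _).trans_lt ?_
    calc ‖C‖ * ‖R‖ ≤ ‖C‖ * μ⁻¹ := by gcongr
      _ < μ * μ⁻¹ := by gcongr
      _ = 1 := mul_inv_cancel₀ hμ.ne'
  obtain ⟨X, hX⟩ := (isUnit_one_sub_of_norm_lt_one hlt).exists_right_inv
  refine ⟨_, hRG (X v), ?_⟩
  have := congrArg (fun Y : H →L[ℝ] H => Y v) hX
  simp only [mul_apply_eq_comp, sub_apply, one_apply_eq_self] at this
  simp only [sub_sub_cancel]
  exact this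

/-- Moving from a to b is a perturbation by the scalar a − b, allowed when 0 < b < 2a. Steps of
ratio 3/2 stay in this window and climb above ν; one last step comes down to ν. -/
theorem IsDissipative.hasFullRange [CompleteSpace H] {G : Submodule ℝ (H × H)}
    (hG : IsDissipative G) {μ : ℝ} (hμ : 0 < μ) (hr : HasFullRange G μ) {ν : ℝ} (hν : 0 < ν) :
    HasFullRange G ν := by
  have step : ∀ {a b : ℝ}, 0 < a → HasFullRange G a → |a - b| < a → HasFullRange G b := by
    intro a b ha har hab v
    obtain ⟨p, hp, h⟩ := hG.exists_of_perturbation ha har ((a - b) • ContinuousLinearMap.id ℝ H)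
      (lt_of_le_of_lt (by
        rw [norm_smul, Real.norm_eq_abs]
        exact mul_le_of_le_one_right (abs_nonneg _) ContinuousLinearMap.norm_id_le) hab) v
    refine ⟨p, hp, ?_⟩
    rw [← h]
    change _ = a • p.1 - p.2 - (a - b) • p.1
    rw [sub_smul]
    abel
  have key : ∀ n : ℕ, HasFullRange G ((3 / 2 : ℝ) ^ n * μ) := by
    intro n
    induction n with
    | zero => simpa using hr
    | succ n ih =>
      have hpos : 0 < (3 / 2 : ℝ) ^ n * μ := by positivity
      refine step hpos ih ?_
      rw [pow_succ, abs_lt]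
      constructor <;> linarith
  obtain ⟨n, hn⟩ := pow_unbounded_of_one_lt (ν / μ) (by norm_num : (1 : ℝ) < 3 / 2)
  rw [div_lt_iff₀ hμ] at hn
  exact step (by positivity) (key n) (by rw [abs_lt]; constructor <;> linarith)

/-- The domain of a maximal dissipative operator is dense. -/
theorem IsDissipative.dense_fst [CompleteSpace H] {G : Submodule ℝ (H × H)}
    (hG : IsDissipative G) {μ : ℝ} (hr : HasFullRange G μ) (hμ : 0 < μ)
    (hsv : ∀ w, (0, w) ∈ G → w = 0) (v : H) {ε : ℝ} (hε : 0 < ε) : ∃ p ∈ G, ‖p.1 - v‖ < ε := by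
  let D : Submodule ℝ H := G.map (LinearMap.fst ℝ H H)
  have hD : D.topologicalClosure = ⊤ := by
    rw [Submodule.topologicalClosure_eq_top_iff, Submodule.eq_bot_iff]
    intro z hz
    -- A vector z orthogonal to the domain is written as μ p.1 − p.2; pairing with p.1 gives μ‖p.1‖²
    -- = ⟨p.2, p.1⟩ ≤ 0, so p.1 = 0, and then p.2 = 0 because `G` is single-valued at 0.
    obtain ⟨p, hp, hpz⟩ := hr z
    have h1 : inner ℝ p.1 z = 0 := hz p.1 ⟨p, hp, rfl⟩
    rw [← hpz, inner_sub_right, real_inner_smul_right, real_inner_self_eq_norm_sq,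
      real_inner_comm] at h1
    have h2 := hG p hp
    have h3 : ‖p.1‖ = 0 := by
      have : ‖p.1‖ ^ 2 ≤ 0 := by nlinarith [sq_nonneg ‖p.1‖]
      exact pow_eq_zero_iff two_ne_zero |>.1 (le_antisymm this (sq_nonneg _))
    rw [norm_eq_zero] at h3
    have h4 : p.2 = 0 := hsv _ (by rw [← h3]; exact hp)
    rw [← hpz, h3, h4]; simp
  have hv : v ∈ D.topologicalClosure := hD ▸ Submodule.mem_top
  obtain ⟨w, ⟨p, hp, rfl⟩, hw⟩ := Metric.mem_closure_iff.1 hv ε hε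
  exact ⟨p, hp, by rwa [dist_eq_norm, norm_sub_rev] at hw⟩

end LumerPhillips

/-! ### Yosida approximation and the Hille–Yosida theorem -/

section HilleYosida

variable {H : Type*} [NormedAddCommGroup H] [InnerProductSpace ℝ H]

theorem tendsto_apply_of_dense {ι : Type*} {l : Filter ι} {T : ι → H →L[ℝ] H}
    (hT : ∀ᶠ i in l, ∀ v, ‖T i v‖ ≤ ‖v‖)
    (h : ∀ v, ∀ ε > 0, ∃ p, ‖p - v‖ < ε ∧ Tendsto (fun i => T i p) l (𝓝 p)) (v : H) :
    Tendsto (fun i => T i v) l (𝓝 v) := by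
  rw [Metric.tendsto_nhds]
  intro ε hε
  obtain ⟨p, hp, hpt⟩ := h v (ε / 3) (by positivity)
  filter_upwards [hT, Metric.tendsto_nhds.1 hpt (ε / 3) (by positivity)] with i hi hi'
  rw [dist_eq_norm] at hi' ⊢
  have h1 := hi (v - p)
  rw [map_sub, norm_sub_rev v p] at h1
  calc ‖T i v - v‖ = ‖(T i v - T i p) + (T i p - p) + (p - v)‖ := by congr 1; abel
    _ ≤ ‖T i v - T i p‖ + ‖T i p - p‖ + ‖p - v‖ := norm_add₃_le
    _ < ε := by linarith

/-- The Yosida approximations are B_n = a(aR − 1) with a = n + 1 and R the resolvent at a. On `G`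
one has B_n p.1 = a R p.2, so convergence reduces to aR → 1 strongly. -/
theorem IsDissipative.exists_yosida [CompleteSpace H] {G : Submodule ℝ (H × H)}
    (hG : IsDissipative G) {μ : ℝ} (hμ : 0 < μ) (hr : HasFullRange G μ)
    (hsv : ∀ w, (0, w) ∈ G → w = 0) :
    ∃ B : ℕ → H →L[ℝ] H, (∀ n v, inner ℝ (B n v) v ≤ 0) ∧ (∀ n m, Commute (B n) (B m)) ∧
      ∀ p ∈ G, Tendsto (fun n => B n p.1) atTop (𝓝 p.2) := by
  have hpos : ∀ n : ℕ, (0 : ℝ) < n + 1 := fun n => by positivity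
  choose R hR hRG hRp using fun n : ℕ =>
    hG.exists_resolvent (hpos n) (hG.hasFullRange hμ hr (hpos n))
  have hRv : ∀ n v, ‖R n v‖ ≤ ((n : ℝ) + 1)⁻¹ * ‖v‖ := fun n v =>
    (R n).le_of_opNorm_le (hR n) v
  have hcomm : ∀ n m, Commute (R n) (R m) := by
    intro n m
    rcases eq_or_ne n m with rfl | hnm
    · exact Commute.refl _
    -- The resolvent identity. Adding it to the copy with n and m exchanged leaves (n − m)(R_n R_m −
    -- R_m R_n) = 0.
    have key : ∀ (n m : ℕ) (v : H), ((n : ℝ) - m) • R n (R m v) + R n v = R m v := by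
      intro n m v
      have := hRp n _ (hRG m v)
      simp only [map_sub, map_smul, add_smul, one_smul, map_add] at this
      conv_rhs => rw [← this]
      rw [sub_smul]
      abel
    ext v
    have h1 := key n m v
    have h2 := key m n v
    have h3 : ((n : ℝ) - m) • (R n (R m v) - R m (R n v)) = 0 := by
      have : ((n : ℝ) - m) • R n (R m v) + R n v + (((m : ℝ) - n) • R m (R n v) + R m v)
        = R m v + R n v := by rw [h1, h2]
      rw [← sub_eq_zero] at this
      rw [← this, ← neg_sub (n : ℝ) m]
      simp only [smul_sub, neg_smul]
      abel
    have h4 : ((n : ℝ) - m) ≠ 0 := sub_ne_zero.2 (by exact_mod_cast hnm)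
    exact sub_eq_zero.1 ((smul_eq_zero.1 h3).resolve_left h4)
  have hRone : ∀ w, Tendsto (fun n : ℕ => (((n : ℝ) + 1) • R n) w) atTop (𝓝 w) := by
    refine tendsto_apply_of_dense (Eventually.of_forall fun n v => ?_) fun v ε hε => ?_
    · rw [smul_apply, norm_smul, Real.norm_of_nonneg (hpos n).le]
      calc ((n : ℝ) + 1) * ‖R n v‖ ≤ ((n : ℝ) + 1) * (((n : ℝ) + 1)⁻¹ * ‖v‖) := by
            gcongr; exact hRv n v
        _ = ‖v‖ := by field_simp
    · obtain ⟨p, hp, hpv⟩ := hG.dense_fst hr hμ hsv v hε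
      refine ⟨p.1, hpv, ?_⟩
      rw [tendsto_iff_norm_sub_tendsto_zero]
      refine squeeze_zero (fun _ => norm_nonneg _)
        (g := fun n : ℕ => ((n : ℝ) + 1)⁻¹ * ‖p.2‖) (fun n => ?_) ?_
      -- On the domain aR p.1 − p.1 = R p.2, which has norm at most ‖p.2‖/a.
      · have := hRp n p hp
        rw [map_sub, map_smul, sub_eq_iff_eq_add, ← sub_eq_iff_eq_add'] at this
        rw [smul_apply, this]
        exact hRv n _
      · have := (tendsto_one_div_add_atTop_nhds_zero_nat (𝕜 := ℝ)).mul_const ‖p.2‖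
        simpa using this
  refine ⟨fun n => ((n : ℝ) + 1) • (((n : ℝ) + 1) • R n - 1), fun n v => ?_, fun n m => ?_,
    fun p hp => ?_⟩
  · set a : ℝ := (n : ℝ) + 1
    have ha : 0 < a := hpos n
    have h1 := hG _ (hRG n v)
    -- This splits ⟨aRv − v, v⟩ into a⟨aRv − v, Rv⟩ − ‖aRv − v‖², and both terms are nonpositive
    -- since (Rv, aRv − v) lies in `G`.
    have h2 : v = a • R n v - (a • R n v - v) := by abel
    have h3 : (a • (a • R n - 1)) v = a • (a • R n v - v) := rfl
    rw [h3, real_inner_smul_left]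
    refine mul_nonpos_of_nonneg_of_nonpos ha.le ?_
    change inner ℝ (a • R n v - v) (R n v) ≤ 0 at h1
    have h4 : inner ℝ (a • R n v - v) v
        = inner ℝ (a • R n v - v) (a • R n v - (a • R n v - v)) := by rw [← h2]
    rw [h4, inner_sub_right, real_inner_smul_right, real_inner_self_eq_norm_sq]
    have : 0 ≤ ‖a • R n v - v‖ ^ 2 := by positivity
    nlinarith [mul_nonpos_of_nonneg_of_nonpos ha.le h1]
  · refine ((Commute.smul_left ?_ _).smul_right _)
    refine ((Commute.sub_left ?_ (Commute.one_left _)).sub_right (Commute.one_right _))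
    exact ((hcomm n m).smul_left _).smul_right _
  · refine (hRone p.2).congr fun n => ?_
    have := hRp n p hp
    rw [map_sub, map_smul, sub_eq_iff_eq_add, ← sub_eq_iff_eq_add'] at this
    change ((n : ℝ) + 1) • R n p.2 = ((n : ℝ) + 1) • (((n : ℝ) + 1) • R n p.1 - p.1)
    rw [this]

section Exp

theorem commute_exp_smul {A B : H →L[ℝ] H} (h : Commute A B) (t : ℝ) :
    Commute A (NormedSpace.exp (t • B)) :=
  (h.smul_right t).exp_right

variable [CompleteSpace H]

theorem hasDerivAt_exp_smul_apply (B : H →L[ℝ] H) (v : H) (t : ℝ) :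
    HasDerivAt (fun t : ℝ => NormedSpace.exp (t • B) v) (B (NormedSpace.exp (t • B) v)) t :=
  (hasDerivAt_exp_smul_const' B t).clm_apply (hasDerivAt_const t v) |>.congr_deriv (by simp)

theorem norm_exp_smul_apply_le {B : H →L[ℝ] H} (hB : ∀ v, inner ℝ (B v) v ≤ 0) {t : ℝ}
    (ht : 0 ≤ t) (v : H) : ‖NormedSpace.exp (t • B) v‖ ≤ ‖v‖ := by
  have hd := fun s : ℝ => (hasDerivAt_exp_smul_apply B v s).norm_sq
  have hanti : Antitone (fun s : ℝ => ‖NormedSpace.exp (s • B) v‖ ^ 2) := by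
    refine antitone_of_deriv_nonpos (fun s => (hd s).differentiableAt) fun s => ?_
    rw [(hd s).deriv, real_inner_comm]
    linarith [hB (NormedSpace.exp (s • B) v)]
  have := hanti ht
  simp only [zero_smul, NormedSpace.exp_zero, one_apply_eq_self] at this
  exact pow_le_pow_iff_left₀ (norm_nonneg _) (norm_nonneg _) two_ne_zero |>.1 this

/-- The path s ↦ e^{sX} e^{(t−s)Y} v joins the two vectors. As X and Y commute, its derivative is
e^{sX} e^{(t−s)Y}(X − Y)v, and both exponentials are contractions. -/
theorem norm_exp_smul_sub_le {X Y : H →L[ℝ] H} (hX : ∀ v, inner ℝ (X v) v ≤ 0)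
    (hY : ∀ v, inner ℝ (Y v) v ≤ 0) (hXY : Commute X Y) {t : ℝ} (ht : 0 ≤ t) (v : H) :
    ‖NormedSpace.exp (t • X) v - NormedSpace.exp (t • Y) v‖ ≤ t * ‖X v - Y v‖ := by
  have hd : ∀ s ∈ Icc 0 t, HasDerivWithinAt
      (fun s : ℝ => NormedSpace.exp (s • X) (NormedSpace.exp ((t - s) • Y) v))
      (NormedSpace.exp (s • X) (NormedSpace.exp ((t - s) • Y) (X v - Y v))) (Icc 0 t) s := by
    intro s _
    have h1 := hasDerivAt_exp_smul_const X s
    have h2 : HasDerivAt (fun s : ℝ => NormedSpace.exp ((t - s) • Y) v)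
        (-(Y (NormedSpace.exp ((t - s) • Y) v))) s := by
      have := (hasDerivAt_exp_smul_apply Y v (t - s)).scomp s ((hasDerivAt_id s).const_sub t)
      simpa [Function.comp_def] using this
    refine ((h1.clm_apply h2).congr_deriv ?_).hasDerivWithinAt
    have c1 := congrArg (fun Z : H →L[ℝ] H => Z v) (commute_exp_smul hXY (t - s)).eq
    have c2 := congrArg (fun Z : H →L[ℝ] H => Z v) (commute_exp_smul (Commute.refl Y) (t - s)).eq
    simp only [mul_apply_eq_comp] at c1 c2 ⊢
    rw [map_neg, map_sub, map_sub, ← c1, ← c2, ← sub_eq_add_neg]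
  have := norm_image_sub_le_of_norm_deriv_le_segment' hd (C := ‖X v - Y v‖) (fun s hs =>
    (norm_exp_smul_apply_le hX hs.1 _).trans
      (norm_exp_smul_apply_le hY (sub_nonneg.2 hs.2.le) _)) t (right_mem_Icc.2 ht)
  simpa [mul_comm] using this

theorem norm_exp_smul_sub_self_le {X : H →L[ℝ] H} (hX : ∀ v, inner ℝ (X v) v ≤ 0) {t : ℝ}
    (ht : 0 ≤ t) (v : H) : ‖NormedSpace.exp (t • X) v - v‖ ≤ t * ‖X v‖ := by
  simpa using norm_exp_smul_sub_le hX (Y := 0) (by simp) (Commute.zero_right X) ht v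

end Exp

/-- The Hille–Yosida theorem for maximal dissipative operators in Hilbert spaces. -/
theorem IsDissipative.exists_semigroup [CompleteSpace H] {G : Submodule ℝ (H × H)}
    (hG : IsDissipative G) {μ : ℝ} (hμ : 0 < μ) (hr : HasFullRange G μ)
    (hsv : ∀ w, (0, w) ∈ G → w = 0) :
    ∃ S : ℝ → H →L[ℝ] H, S 0 = ContinuousLinearMap.id ℝ H ∧
      (∀ s t, 0 ≤ s → 0 ≤ t → S (s + t) = (S s).comp (S t)) ∧
      (∀ v, Tendsto (fun t => S t v) (𝓝[>] 0) (𝓝 v)) ∧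
      ∀ v w, Tendsto (fun t : ℝ => t⁻¹ • (S t v - v)) (𝓝[>] 0) (𝓝 w) ↔ (v, w) ∈ G := by
  obtain ⟨B, hB, hcomm, hBG⟩ := hG.exists_yosida hμ hr hsv
  have hlim : ∀ t : ℝ, 0 ≤ t → ∀ v, ∃ y,
      Tendsto (fun n => NormedSpace.exp (t • B n) v) atTop (𝓝 y) := by
    intro t ht v
    refine cauchySeq_tendsto_of_complete (Metric.cauchySeq_iff.2 fun ε hε => ?_)
    obtain ⟨p, hp, hpv⟩ := hG.dense_fst hr hμ hsv v (ε := ε / 4) (by positivity)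
    -- The denominator has t + 1 instead of t so that t = 0 is covered.
    have hC := Metric.cauchySeq_iff.1 (hBG p hp).cauchySeq (ε / (4 * (t + 1))) (by positivity)
    obtain ⟨N, hN⟩ := hC
    refine ⟨N, fun m hm n hn => ?_⟩
    have h1 := norm_exp_smul_apply_le (hB m) ht (v - p.1)
    have h2 := norm_exp_smul_apply_le (hB n) ht (v - p.1)
    have h3 := norm_exp_smul_sub_le (hB m) (hB n) (hcomm m n) ht p.1
    have h4 := hN m hm n hn
    rw [dist_eq_norm] at h4 ⊢
    rw [map_sub, norm_sub_rev v] at h1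
    rw [map_sub, norm_sub_rev v, norm_sub_rev] at h2
    have h5 : t * ‖B m p.1 - B n p.1‖ ≤ ε / 4 := by
      calc t * ‖B m p.1 - B n p.1‖ ≤ (t + 1) * (ε / (4 * (t + 1))) := by
            gcongr; linarith
        _ = ε / 4 := by field_simp
    calc _ = ‖(NormedSpace.exp (t • B m) v - NormedSpace.exp (t • B m) p.1)
          + (NormedSpace.exp (t • B m) p.1 - NormedSpace.exp (t • B n) p.1)
          + (NormedSpace.exp (t • B n) p.1 - NormedSpace.exp (t • B n) v)‖ := by
          congr 1; abel
      _ ≤ _ := norm_add₃_le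
      _ < ε := by linarith
  have hS : ∀ t : ℝ, ∃ S : H →L[ℝ] H, 0 ≤ t → ∀ v,
      Tendsto (fun n => NormedSpace.exp (t • B n) v) atTop (𝓝 (S v)) := by
    intro t
    by_cases ht : 0 ≤ t
    · choose y hy using hlim t ht
      exact ⟨continuousLinearMapOfTendsto (fun n => NormedSpace.exp (t • B n))
        (tendsto_pi_nhds.2 hy), fun _ => hy⟩
    · exact ⟨0, fun h => absurd h ht⟩
  choose S hS using hS
  have hcontr : ∀ t : ℝ, 0 ≤ t → ∀ v, ‖S t v‖ ≤ ‖v‖ := fun t ht v =>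
    le_of_tendsto (hS t ht v).norm
      (Eventually.of_forall fun n => norm_exp_smul_apply_le (hB n) ht v)
  have hlip : ∀ p ∈ G, ∀ t : ℝ, 0 ≤ t → ‖S t p.1 - p.1‖ ≤ t * ‖p.2‖ := fun p hp t ht =>
    le_of_tendsto_of_tendsto ((hS t ht p.1).sub_const p.1).norm
      ((hBG p hp).norm.const_mul t)
      (Eventually.of_forall fun n => norm_exp_smul_sub_self_le (hB n) ht p.1)
  have hcont : ∀ v, Tendsto (fun t => S t v) (𝓝[>] 0) (𝓝 v) := by
    refine tendsto_apply_of_dense ?_ fun v ε hε => ?_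
    · filter_upwards [self_mem_nhdsWithin] with t ht using hcontr t (le_of_lt ht)
    · obtain ⟨p, hp, hpv⟩ := hG.dense_fst hr hμ hsv v hε
      refine ⟨p.1, hpv, ?_⟩
      rw [tendsto_iff_norm_sub_tendsto_zero]
      refine squeeze_zero' (Eventually.of_forall fun _ => norm_nonneg _)
        (g := fun t : ℝ => t * ‖p.2‖) ?_ ?_
      · filter_upwards [self_mem_nhdsWithin] with t ht using hlip p hp t (le_of_lt ht)
      · have : Tendsto (fun t : ℝ => t * ‖p.2‖) (𝓝 0) (𝓝 (0 * ‖p.2‖)) :=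
          (continuous_id.mul continuous_const).tendsto 0
        rw [zero_mul] at this
        exact this.mono_left nhdsWithin_le_nhds
  have hgen : ∀ p ∈ G, Tendsto (fun t : ℝ => t⁻¹ • (S t p.1 - p.1)) (𝓝[>] 0) (𝓝 p.2) := by
    intro p hp
    rw [Metric.tendsto_nhds]
    intro ε hε
    obtain ⟨q, hq, hqp⟩ := hG.dense_fst hr hμ hsv p.2 (ε := ε / 4) (by positivity)
    -- Since `p.2` need not lie in the domain, it is compared with `q.1`, where the exponential
    -- moves by at most s‖B_n q.1‖. Integrating e^{sB_n}B_n p.1 − p.2 over [0, t] gives the bound,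
    -- and the term ‖B_n p.1 − p.2‖ disappears as n → ∞.
    have hbd : ∀ t : ℝ, 0 ≤ t → ‖S t p.1 - p.1 - t • p.2‖ ≤ t * (2 * ‖q.1 - p.2‖ + t * ‖q.2‖) := by
      intro t ht
      have h1 : ∀ n, ‖NormedSpace.exp (t • B n) p.1 - p.1 - t • p.2‖
          ≤ (‖B n p.1 - p.2‖ + 2 * ‖q.1 - p.2‖ + t * ‖B n q.1‖) * t := by
        intro n
        have hd : ∀ s ∈ Icc 0 t, HasDerivWithinAt
            (fun s : ℝ => NormedSpace.exp (s • B n) p.1 - s • p.2)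
            (NormedSpace.exp (s • B n) (B n p.1) - p.2) (Icc 0 t) s := by
          intro s _
          have c := congrArg (fun Z : H →L[ℝ] H => Z p.1)
            (commute_exp_smul (Commute.refl (B n)) s).eq
          simp only [mul_apply_eq_comp] at c
          rw [← c]
          have h2 := (hasDerivAt_id s).smul_const p.2
          rw [one_smul] at h2
          exact ((hasDerivAt_exp_smul_apply (B n) p.1 s).sub h2).hasDerivWithinAt
        have := norm_image_sub_le_of_norm_deriv_le_segment' hd
          (C := ‖B n p.1 - p.2‖ + 2 * ‖q.1 - p.2‖ + t * ‖B n q.1‖) (fun s hs => ?_) t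
          (right_mem_Icc.2 ht)
        · have e : NormedSpace.exp (t • B n) p.1 - p.1 - t • p.2
              = NormedSpace.exp (t • B n) p.1 - t • p.2
                - (NormedSpace.exp ((0 : ℝ) • B n) p.1 - (0 : ℝ) • p.2) := by
            simp only [zero_smul, NormedSpace.exp_zero, one_apply_eq_self, sub_zero]
            abel
          rw [e]
          simpa using this
        · have a1 := norm_exp_smul_apply_le (hB n) hs.1 (B n p.1 - p.2)
          have a2 := norm_exp_smul_apply_le (hB n) hs.1 (p.2 - q.1)
          have a3 := norm_exp_smul_sub_self_le (hB n) hs.1 q.1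
          have a4 : s * ‖B n q.1‖ ≤ t * ‖B n q.1‖ := by gcongr; exact hs.2.le
          rw [norm_sub_rev p.2] at a2
          calc _ = ‖NormedSpace.exp (s • B n) (B n p.1 - p.2)
                + NormedSpace.exp (s • B n) (p.2 - q.1)
                + (NormedSpace.exp (s • B n) q.1 - q.1) + (q.1 - p.2)‖ := by
                simp only [map_sub]; congr 1; abel
            _ ≤ _ := norm_add₄_le
            _ ≤ _ := by linarith
      have hl := (((hS t ht p.1).sub_const p.1).sub_const (t • p.2)).norm
      have hr' : Tendsto (fun n => (‖B n p.1 - p.2‖ + 2 * ‖q.1 - p.2‖ + t * ‖B n q.1‖) * t) atTop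
          (𝓝 ((‖p.2 - p.2‖ + 2 * ‖q.1 - p.2‖ + t * ‖q.2‖) * t)) :=
        (((((hBG p hp).sub_const p.2).norm).add_const _).add
          ((hBG q hq).norm.const_mul t)).mul_const t
      refine (le_of_tendsto_of_tendsto hl hr' (Eventually.of_forall h1)).trans (le_of_eq ?_)
      rw [sub_self, norm_zero]; ring
    have hsmall : ∀ᶠ t : ℝ in 𝓝[>] 0, t * ‖q.2‖ < ε / 4 := by
      have : Tendsto (fun t : ℝ => t * ‖q.2‖) (𝓝 0) (𝓝 (0 * ‖q.2‖)) :=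
        (continuous_id.mul continuous_const).tendsto 0
      rw [zero_mul] at this
      exact (this.mono_left nhdsWithin_le_nhds).eventually (gt_mem_nhds (by positivity))
    filter_upwards [self_mem_nhdsWithin, hsmall] with t ht hts
    have ht' : (0 : ℝ) < t := ht
    rw [dist_eq_norm]
    have e : t⁻¹ • (S t p.1 - p.1) - p.2 = t⁻¹ • (S t p.1 - p.1 - t • p.2) := by
      rw [smul_sub t⁻¹ _ (t • p.2), smul_smul, inv_mul_cancel₀ ht'.ne', one_smul]
    rw [e, norm_smul, norm_inv, Real.norm_of_nonneg ht'.le, inv_mul_lt_iff₀ ht']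
    refine (hbd t ht'.le).trans_lt ?_
    gcongr
    linarith
  refine ⟨S, ?_, fun s t hs ht => ?_, hcont, fun v w => ⟨fun h => ?_, hgen (v, w)⟩⟩
  · ext v
    refine tendsto_nhds_unique (hS 0 le_rfl v) ?_
    simp
  · ext v
    have h1 : Tendsto (fun n => NormedSpace.exp (s • B n) (NormedSpace.exp (t • B n) v)) atTop
        (𝓝 (S (s + t) v)) := by
      refine (hS (s + t) (add_nonneg hs ht) v).congr fun n => ?_
      let _ : NormedAlgebra ℚ (H →L[ℝ] H) := NormedAlgebra.restrictScalars ℚ ℝ _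
      rw [add_smul, NormedSpace.exp_add_of_commute
        (((Commute.refl (B n)).smul_left s).smul_right t)]
      rfl
    have h2 : Tendsto (fun n => NormedSpace.exp (s • B n) (NormedSpace.exp (t • B n) v - S t v))
        atTop (𝓝 0) := by
      refine squeeze_zero_norm (fun n => norm_exp_smul_apply_le (hB n) hs _) ?_
      simpa using ((hS t ht v).sub_const (S t v)).norm
    have h3 := h2.add (hS s hs (S t v))
    simp only [map_sub, sub_add_cancel, zero_add] at h3
    exact tendsto_nhds_unique h1 h3
  -- The generator is no larger than `G`: with p in `G` solving p.1 − p.2 = v − w, the generator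
  -- maps v − p.1 to itself. A contraction semigroup has a dissipative generator, so v = p.1.
  · obtain ⟨p, hp, hpv⟩ := hG.hasFullRange hμ hr one_pos (v - w)
    rw [one_smul] at hpv
    have h1 := h.sub (hgen p hp)
    have e1 : w - p.2 = v - p.1 := by rw [← sub_eq_zero] at hpv ⊢; rw [← hpv]; abel
    rw [e1] at h1
    have h2 : Tendsto (fun t : ℝ => t⁻¹ • (S t (v - p.1) - (v - p.1))) (𝓝[>] 0)
        (𝓝 (v - p.1)) := by
      refine h1.congr fun t => ?_
      rw [← smul_sub, map_sub]
      congr 1; abel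
    have h3 : Tendsto (fun t : ℝ => inner ℝ (t⁻¹ • (S t (v - p.1) - (v - p.1))) (v - p.1))
        (𝓝[>] 0) (𝓝 (inner ℝ (v - p.1) (v - p.1))) := h2.inner tendsto_const_nhds
    have h4 : inner ℝ (v - p.1) (v - p.1) ≤ 0 := by
      refine le_of_tendsto h3 ?_
      filter_upwards [self_mem_nhdsWithin] with t ht
      have ht' : (0 : ℝ) < t := ht
      rw [real_inner_smul_left, inner_sub_left, real_inner_self_eq_norm_sq]
      have h5 := (real_inner_le_norm (S t (v - p.1)) (v - p.1)).trans
        (mul_le_mul_of_nonneg_right (hcontr t ht'.le (v - p.1)) (norm_nonneg _))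
      refine mul_nonpos_of_nonneg_of_nonpos (inv_nonneg.2 ht'.le) ?_
      rw [sq]; linarith
    have h6 : v - p.1 = 0 := real_inner_self_nonpos.1 h4
    have h7 : (v, w) = p := by
      refine Prod.ext (sub_eq_zero.1 h6) (sub_eq_zero.1 ?_)
      rw [e1, h6]
    rw [h7]
    exact hp

end HilleYosida

/-! ### A criterion for essential skew-adjointness -/

section EssentiallySkewAdjoint

variable {H : Type*} [NormedAddCommGroup H] [InnerProductSpace ℝ H]

/-- The graph of `-D*`, where `G` is the graph of `D`. -/
def negAdjoint (G : Submodule ℝ (H × H)) : Submodule ℝ (H × H) where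
  carrier := {q | ∀ p ∈ G, inner ℝ q.1 p.2 = - inner ℝ q.2 p.1}
  add_mem' {a b} ha hb p hp := by
    simp only [Prod.fst_add, Prod.snd_add, inner_add_left, ha p hp, hb p hp]; ring
  zero_mem' p _ := by simp
  smul_mem' c a ha p hp := by
    simp only [Prod.smul_fst, Prod.smul_snd, real_inner_smul_left, ha p hp]; ring

theorem isClosed_negAdjoint (G : Submodule ℝ (H × H)) : IsClosed (negAdjoint G : Set (H × H)) := by
  have : (negAdjoint G : Set (H × H))
      = ⋂ p ∈ G, {q : H × H | inner ℝ q.1 p.2 = - inner ℝ q.2 p.1} := by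
    ext q; simp [negAdjoint]
  rw [this]
  exact isClosed_biInter fun p _ => isClosed_eq (by fun_prop) (by fun_prop)

variable [CompleteSpace H] {G : Submodule ℝ (H × H)}

/-- Skew symmetry gives ‖a p.1 + p.2‖² = a²‖p.1‖² + ‖p.2‖². If the images under a + G converge, the
pairs themselves are therefore Cauchy, so the closure has closed range; `hd` says that this range is
dense. -/
theorem exists_mem_topologicalClosure_smul_add (hG : G ≤ negAdjoint G) {a : ℝ} (ha : a ≠ 0)
    (hd : ∀ z, (∀ p ∈ G, inner ℝ z (a • p.1 + p.2) = 0) → z = 0) (v : H) :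
    ∃ q ∈ G.topologicalClosure, a • q.1 + q.2 = v := by
  let L : H × H →ₗ[ℝ] H := a • LinearMap.fst ℝ H H + LinearMap.snd ℝ H H
  have hL : ∀ p, L p = a • p.1 + p.2 := fun p => rfl
  have hdense : (G.map L).topologicalClosure = ⊤ := by
    rw [Submodule.topologicalClosure_eq_top_iff, Submodule.eq_bot_iff]
    intro z hz
    refine hd z fun p hp => ?_
    rw [real_inner_comm]
    exact hz (L p) ⟨p, hp, rfl⟩
  have hv : v ∈ (G.map L).topologicalClosure := hdense ▸ Submodule.mem_top
  obtain ⟨x, hx, hxv⟩ := mem_closure_iff_seq_limit.1 hv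
  choose p hp hpx using hx
  have hnorm : ∀ p ∈ G, ‖L p‖ ^ 2 = a ^ 2 * ‖p.1‖ ^ 2 + ‖p.2‖ ^ 2 := by
    intro p hp
    have h := hG hp p hp
    rw [real_inner_comm] at h
    rw [hL, norm_add_sq_real, norm_smul, mul_pow, Real.norm_eq_abs, sq_abs, real_inner_smul_left,
      real_inner_comm]
    have : inner ℝ p.2 p.1 = 0 := by linarith [real_inner_comm p.1 p.2]
    rw [this]; ring
  have hc : CauchySeq (fun n => L (p n)) := by
    simp only [hpx]; exact hxv.cauchySeq
  have hcp : CauchySeq p := by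
    rw [Metric.cauchySeq_iff] at hc ⊢
    intro ε hε
    obtain ⟨N, hN⟩ := hc (min ε (|a| * ε)) (by positivity)
    refine ⟨N, fun m hm n hn => ?_⟩
    have h1 := hN m hm n hn
    rw [dist_eq_norm, ← map_sub] at h1
    have h2 := hnorm _ (G.sub_mem (hp m) (hp n))
    rw [dist_eq_norm, Prod.norm_def, max_lt_iff]
    obtain ⟨h3, h4⟩ := lt_min_iff.1 h1
    constructor
    · have : |a| * ‖(p m - p n).1‖ ≤ ‖L (p m - p n)‖ := by
        refine abs_le_of_sq_le_sq' ?_ (norm_nonneg _) |>.2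
        rw [mul_pow, sq_abs, h2]
        nlinarith [sq_nonneg ‖(p m - p n).2‖]
      exact lt_of_mul_lt_mul_left (this.trans_lt h4) (abs_nonneg a)
    · have : ‖(p m - p n).2‖ ≤ ‖L (p m - p n)‖ := by
        refine abs_le_of_sq_le_sq' ?_ (norm_nonneg _) |>.2
        rw [h2]
        nlinarith [mul_nonneg (sq_nonneg a) (sq_nonneg ‖(p m - p n).1‖)]
      exact this.trans_lt h3
  obtain ⟨q, hq⟩ := cauchySeq_tendsto_of_complete hcp
  refine ⟨q, mem_closure_iff_seq_limit.2 ⟨p, hp, hq⟩, ?_⟩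
  have h1 : Tendsto (fun n => a • (p n).1 + (p n).2) atTop (𝓝 (a • q.1 + q.2)) :=
    ((hq.fst_nhds).const_smul a).add hq.snd_nhds
  refine tendsto_nhds_unique h1 (hxv.congr fun n => ?_)
  rw [← hpx, hL]

/-- For q in the larger relation, choose r in the closure with r.1 + r.2 = q.1 + q.2. Then q − r has
the form (z, −z), which makes z orthogonal to the range of −1 + G, so z = 0. -/
theorem topologicalClosure_eq_negAdjoint (hG : G ≤ negAdjoint G)
    (hd : ∀ a : ℝ, a ≠ 0 → ∀ z, (∀ p ∈ G, inner ℝ z (a • p.1 + p.2) = 0) → z = 0) :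
    G.topologicalClosure = negAdjoint G := by
  have hle : G.topologicalClosure ≤ negAdjoint G :=
    G.topologicalClosure_minimal hG (isClosed_negAdjoint G)
  refine le_antisymm hle fun q hq => ?_
  obtain ⟨r, hr, hrq⟩ := exists_mem_topologicalClosure_smul_add hG one_ne_zero
    (hd 1 one_ne_zero) (q.1 + q.2)
  rw [one_smul] at hrq
  have hm := (negAdjoint G).sub_mem hq (hle hr)
  have h2 : (q - r).2 = - (q - r).1 := by
    rw [← sub_eq_zero] at hrq
    rw [eq_neg_iff_add_eq_zero, ← neg_eq_zero, ← hrq, Prod.fst_sub, Prod.snd_sub]; abel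
  have h1 : (q - r).1 = 0 := by
    refine hd (-1) (by norm_num) _ fun p hp => ?_
    have := hm p hp
    rw [inner_add_right, this, h2, real_inner_smul_right, inner_neg_left]; ring
  have h0 : q - r = 0 := Prod.ext h1 (by rw [h2, h1, neg_zero]; rfl)
  rw [sub_eq_zero.1 h0]
  exact hr

/-- For r in `G` this is the definition of `negAdjoint`. It is a closed condition on r, and the
closure of `G` is all of `negAdjoint G`. -/
theorem inner_negAdjoint (hG : G ≤ negAdjoint G)
    (hd : ∀ a : ℝ, a ≠ 0 → ∀ z, (∀ p ∈ G, inner ℝ z (a • p.1 + p.2) = 0) → z = 0)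
    {q r : H × H} (hq : q ∈ negAdjoint G) (hr : r ∈ negAdjoint G) :
    inner ℝ q.1 r.2 = - inner ℝ q.2 r.1 := by
  rw [← topologicalClosure_eq_negAdjoint hG hd] at hr
  have hcl : IsClosed {r : H × H | inner ℝ q.1 r.2 = - inner ℝ q.2 r.1} :=
    isClosed_eq (by fun_prop) (by fun_prop)
  exact closure_minimal (s := (G : Set (H × H))) (fun p hp => hq p hp) hcl hr

end EssentiallySkewAdjoint

/-! ### Skew-adjointness of the weak derivative on the line -/

theorem inner_L2 (v w : L2) : inner ℝ v w = ∫ x, v x * w x := by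
  rw [L2.inner_def]
  refine integral_congr_ae (Eventually.of_forall fun x => ?_)
  simp [mul_comm]

theorem inner_L2_of_ae {v w : L2} {f g : ℝ → ℝ} (hf : v =ᵐ[volume] f) (hg : w =ᵐ[volume] g) :
    inner ℝ v w = ∫ x, f x * g x := by
  rw [inner_L2]
  refine integral_congr_ae ?_
  filter_upwards [hf, hg] with x h1 h2
  rw [h1, h2]

theorem memLp_deriv_test {φ : ℝ → ℝ} (hφ : ContDiff ℝ ∞ φ) (hc : HasCompactSupport φ) :
    MemLp (deriv φ) 2 volume :=
  (hφ.continuous_deriv (by simp)).memLp_of_hasCompactSupport hc.deriv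

/-- The graph of the derivative on test functions, as a subspace of `L² × L²`. -/
def testGraph : Submodule ℝ (L2 × L2) where
  carrier := {p | ∃ φ : ℝ → ℝ, ContDiff ℝ ∞ φ ∧ HasCompactSupport φ ∧
    p.1 =ᵐ[volume] φ ∧ p.2 =ᵐ[volume] deriv φ}
  add_mem' := by
    rintro a b ⟨φ, h1, h2, h3, h4⟩ ⟨ψ, k1, k2, k3, k4⟩
    refine ⟨φ + ψ, h1.add k1, h2.add k2, (Lp.coeFn_add _ _).trans (h3.add k3),
      (Lp.coeFn_add _ _).trans ((h4.add k4).trans (Eventually.of_forall fun x => ?_))⟩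
    exact (deriv_add (h1.differentiable (by simp) x) (k1.differentiable (by simp) x)).symm
  zero_mem' := by
    refine ⟨0, contDiff_const, HasCompactSupport.zero, Lp.coeFn_zero _ _ _,
      (Lp.coeFn_zero _ _ _).trans (Eventually.of_forall fun x => ?_)⟩
    simp
  smul_mem' := by
    rintro c a ⟨φ, h1, h2, h3, h4⟩
    refine ⟨c • φ, contDiff_const.smul h1, h2.smul_left (f := fun _ => c),
      (Lp.coeFn_smul _ _).trans (h3.const_smul c),
      (Lp.coeFn_smul _ _).trans ((h4.const_smul c).trans (Eventually.of_forall fun x => ?_))⟩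
    exact (deriv_const_smul c (h1.differentiable (by simp) x)).symm

theorem hasWeakDeriv_iff {v w : L2} : HasWeakDeriv v w ↔ (v, w) ∈ negAdjoint testGraph := by
  constructor
  · rintro h p ⟨φ, h1, h2, h3, h4⟩
    rw [inner_L2_of_ae (EventuallyEq.refl _ _) h4, inner_L2_of_ae (EventuallyEq.refl _ _) h3]
    exact h φ h1 h2
  · intro h φ h1 h2
    have m1 := h1.continuous.memLp_of_hasCompactSupport (p := 2) (μ := volume) h2
    have m2 := memLp_deriv_test h1 h2
    have := h (m1.toLp φ, m2.toLp _) ⟨φ, h1, h2, m1.coeFn_toLp, m2.coeFn_toLp⟩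
    rwa [inner_L2_of_ae (EventuallyEq.refl _ _) m1.coeFn_toLp,
      inner_L2_of_ae (EventuallyEq.refl _ _) m2.coeFn_toLp] at this

theorem testGraph_le : testGraph ≤ negAdjoint testGraph := by
  rintro p ⟨φ, h1, h2, h3, h4⟩ q ⟨ψ, k1, k2, k3, k4⟩
  rw [inner_L2_of_ae h3 k4, inner_L2_of_ae h4 k3]
  have cφ := h1.continuous
  have cψ := k1.continuous
  have cφ' := h1.continuous_deriv (by simp)
  have cψ' := k1.continuous_deriv (by simp)
  exact integral_mul_deriv_eq_deriv_mul_of_integrable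
    (fun x _ => (h1.differentiable (by simp) x).hasDerivAt)
    (fun x _ => (k1.differentiable (by simp) x).hasDerivAt)
    ((cφ.mul cψ').integrable_of_hasCompactSupport h2.mul_right)
    ((cφ'.mul cψ).integrable_of_hasCompactSupport h2.deriv.mul_right)
    ((cφ.mul cψ).integrable_of_hasCompactSupport h2.mul_right)

theorem abs_integral_mul_translate_le (z : L2) {φ : ℝ → ℝ} (hφ : MemLp φ 2 volume) (s : ℝ) :
    |∫ x, z x * φ (x - s)| ≤ ‖z‖ * (eLpNorm φ 2 volume).toReal := by
  have mp : MeasurePreserving (fun x : ℝ => x - s) volume volume := measurePreserving_sub_right _ s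
  have m : MemLp (fun x => φ (x - s)) 2 volume := hφ.comp_measurePreserving mp
  rw [← inner_L2_of_ae (EventuallyEq.refl _ _) m.coeFn_toLp]
  refine (abs_real_inner_le_norm _ _).trans_eq ?_
  rw [Lp.norm_toLp]
  congr 2
  exact eLpNorm_comp_measurePreserving hφ.1 mp

/-- The product ψ(s)e^{−as} is constant. It is evaluated at s = n/a, where the exponential is e^{−n}
for either sign of a. -/
theorem eq_zero_of_bounded_exp {ψ : ℝ → ℝ} {a C : ℝ} (ha : a ≠ 0)
    (hψ : ∀ s, HasDerivAt ψ (a * ψ s) s) (hb : ∀ s, |ψ s| ≤ C) : ψ 0 = 0 := by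
  have hconst : ∀ s, ψ s * Real.exp (-a * s) = ψ 0 := by
    intro s
    have hd : ∀ s, HasDerivAt (fun s => ψ s * Real.exp (-a * s)) 0 s := fun s => by
      have h2 : HasDerivAt (fun s => Real.exp (-a * s)) (Real.exp (-a * s) * (-a * 1)) s :=
        ((hasDerivAt_id s).const_mul (-a)).exp
      exact ((hψ s).mul h2).congr_deriv (by ring)
    have := is_const_of_deriv_eq_zero (fun s => (hd s).differentiableAt) (fun s => (hd s).deriv) s 0
    simpa using this
  have hbd : ∀ n : ℕ, |ψ 0| ≤ C * Real.exp (-n) := by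
    intro n
    have h1 := hconst (n / a)
    have h2 : -a * (n / a) = -n := by field_simp
    rw [h2] at h1
    rw [← h1, abs_mul, Real.abs_exp]
    gcongr
    exact hb _
  have hl : Tendsto (fun n : ℕ => C * Real.exp (-n)) atTop (𝓝 (C * 0)) :=
    (Real.tendsto_exp_neg_atTop_nhds_zero.comp tendsto_natCast_atTop_atTop).const_mul C
  rw [mul_zero] at hl
  have := ge_of_tendsto' hl hbd
  exact abs_nonpos_iff.1 this

/-- The hypothesis says that z' = a z weakly. Testing with translates of φ, the function ψ(s) = ∫
z(x) φ(x − s) dx satisfies ψ' = aψ and is bounded by Cauchy–Schwarz, hence ψ(0) = 0. -/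
theorem eq_zero_of_inner_testGraph {a : ℝ} (ha : a ≠ 0) (z : L2)
    (hz : ∀ p ∈ testGraph, inner ℝ z (a • p.1 + p.2) = 0) : z = 0 := by
  have hint : ∀ φ : ℝ → ℝ, ContDiff ℝ ∞ φ → HasCompactSupport φ →
      a * ∫ x, z x * φ x = - ∫ x, z x * deriv φ x := by
    intro φ h1 h2
    have m1 := h1.continuous.memLp_of_hasCompactSupport (p := 2) (μ := volume) h2
    have m2 := memLp_deriv_test h1 h2
    have := hz (m1.toLp φ, m2.toLp _) ⟨φ, h1, h2, m1.coeFn_toLp, m2.coeFn_toLp⟩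
    rw [inner_add_right, real_inner_smul_right,
      inner_L2_of_ae (EventuallyEq.refl _ _) m1.coeFn_toLp,
      inner_L2_of_ae (EventuallyEq.refl _ _) m2.coeFn_toLp] at this
    linarith
  have hloc : LocallyIntegrable z volume := (Lp.memLp z).locallyIntegrable (by norm_num)
  refine Lp.ext (EventuallyEq.trans ?_ (Lp.coeFn_zero _ _ _).symm)
  refine ae_eq_zero_of_integral_contDiff_smul_eq_zero hloc fun φ h1 h2 => ?_
  have m1 := h1.continuous.memLp_of_hasCompactSupport (p := 2) (μ := volume) h2
  have key := eq_zero_of_bounded_exp (ψ := fun s => ∫ x, z x * φ (x - s)) ha (fun s => ?_)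
    (abs_integral_mul_translate_le z m1)
  · simpa [mul_comm] using key
  · have hc : HasCompactSupport (fun x => φ (-x)) := h2.comp_homeomorph (Homeomorph.neg ℝ)
    have hd : ContDiff ℝ 1 (fun x => φ (-x)) := (h1.of_le (by simp)).comp contDiff_neg
    -- ψ is the convolution of z with the reflected test function, so the derivative in s falls on
    -- the smooth factor.
    have := hc.hasDerivAt_convolution_right (ContinuousLinearMap.lsmul ℝ ℝ) hloc hd s
    have e1 : convolution z (fun x => φ (-x)) (ContinuousLinearMap.lsmul ℝ ℝ) volume
        = fun s => ∫ x, z x * φ (x - s) := by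
      funext s
      rw [convolution_lsmul]
      simp
    rw [e1] at this
    refine this.congr_deriv ?_
    rw [convolution_lsmul]
    have hs := hint (fun x => φ (x - s)) (h1.comp (contDiff_id.sub contDiff_const))
      (h2.comp_homeomorph (Homeomorph.subRight s))
    rw [hs, ← integral_neg]
    refine integral_congr_ae (Eventually.of_forall fun x => ?_)
    simp only [smul_eq_mul]
    rw [deriv_comp_sub_const, deriv_comp_neg]
    simp

theorem HasWeakDeriv.inner_eq {v v' w w' : L2} (hv : HasWeakDeriv v v') (hw : HasWeakDeriv w w') :
    inner ℝ v w' = - inner ℝ v' w :=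
  inner_negAdjoint testGraph_le (fun _ ha => eq_zero_of_inner_testGraph ha)
    (hasWeakDeriv_iff.1 hv) (hasWeakDeriv_iff.1 hw)

theorem HasWeakDeriv.inner_self {v v' : L2} (hv : HasWeakDeriv v v') : inner ℝ v v' = 0 := by
  have h := hv.inner_eq hv
  rw [real_inner_comm v] at h
  linarith [real_inner_comm v v']

theorem exists_hasWeakDeriv_smul_add {a : ℝ} (ha : a ≠ 0) (v : L2) :
    ∃ w w' : L2, HasWeakDeriv w w' ∧ a • w + w' = v := by
  obtain ⟨q, hq, h⟩ := exists_mem_topologicalClosure_smul_add testGraph_le ha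
    (eq_zero_of_inner_testGraph ha) v
  rw [topologicalClosure_eq_negAdjoint testGraph_le
    (fun _ ha => eq_zero_of_inner_testGraph ha)] at hq
  exact ⟨q.1, q.2, hasWeakDeriv_iff.2 hq, h⟩

theorem HasWeakDeriv.add {v v' w w' : L2} (hv : HasWeakDeriv v v') (hw : HasWeakDeriv w w') :
    HasWeakDeriv (v + w) (v' + w') :=
  hasWeakDeriv_iff.2 ((negAdjoint testGraph).add_mem (hasWeakDeriv_iff.1 hv)
    (hasWeakDeriv_iff.1 hw))

theorem HasWeakDeriv.const_smul {v v' : L2} (hv : HasWeakDeriv v v') (c : ℝ) :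
    HasWeakDeriv (c • v) (c • v') :=
  hasWeakDeriv_iff.2 ((negAdjoint testGraph).smul_mem c (hasWeakDeriv_iff.1 hv))

theorem hasWeakDeriv_zero : HasWeakDeriv 0 0 :=
  hasWeakDeriv_iff.2 (negAdjoint testGraph).zero_mem

theorem hasWeakDeriv_of_tendsto {ι : Type*} {l : Filter ι} [l.NeBot] {v v' : ι → L2} {w w' : L2}
    (h : ∀ i, HasWeakDeriv (v i) (v' i)) (hv : Tendsto v l (𝓝 w)) (hv' : Tendsto v' l (𝓝 w')) :
    HasWeakDeriv w w' :=
  hasWeakDeriv_iff.2 ((isClosed_negAdjoint testGraph).mem_of_tendsto (hv.prodMk_nhds hv')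
    (Eventually.of_forall fun i => hasWeakDeriv_iff.1 (h i)))

/-! ### The operator −∂³ + ∂² − λ₀ and its semigroup -/

/-- Multiplication by a bounded function as a bounded operator on `L²`. -/
def mulOp (a : Linf) : L2 →L[ℝ] L2 :=
  LinearMap.mkContinuous
    { toFun := fun v => (a • v : L2)
      map_add' := fun v w => Lp.add_smul a v w
      map_smul' := fun c v => (Lp.smul_comm c a v).symm } ‖a‖
    (fun v => Lp.norm_smul_le a v)

theorem mulOp_apply (a : Linf) (v : L2) : mulOp a v = (a • v : L2) := rfl

theorem norm_mulOp_le (a : Linf) : ‖mulOp a‖ ≤ ‖a‖ :=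
  LinearMap.mkContinuous_norm_le _ (norm_nonneg _) _

theorem norm_mulOp_apply_le (a : Linf) (v : L2) : ‖mulOp a v‖ ≤ ‖a‖ * ‖v‖ :=
  Lp.norm_smul_le a v

theorem abs_inner_mulOp_le (a : Linf) (v w : L2) : |inner ℝ (mulOp a v) w| ≤ ‖a‖ * ‖v‖ * ‖w‖ :=
  (abs_real_inner_le_norm _ _).trans
    (mul_le_mul_of_nonneg_right (norm_mulOp_apply_le a v) (norm_nonneg _))

theorem inner_mulOp (a : Linf) (v w : L2) :
    inner ℝ (mulOp a v) w = ∫ x, a x * v x * w x := by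
  have h : mulOp a v =ᵐ[volume] fun x => a x * v x := Lp.coeFn_lpSMul (r := 2) a v
  exact inner_L2_of_ae h (EventuallyEq.refl _ _)

/-- Uniqueness of weak derivatives trades the chosen `weakDeriv` for explicit witnesses, for which
linearity is immediate. -/
theorem memH_three_and_iff {lam0 : Linf} {v w : L2} :
    (MemH 3 v ∧ kdvbOperator lam0 v = w) ↔ ∃ v1 v2 v3 : L2, HasWeakDeriv v v1 ∧
      HasWeakDeriv v1 v2 ∧ HasWeakDeriv v2 v3 ∧ - v3 + v2 - mulOp lam0 v = w := by
  constructor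
  · rintro ⟨⟨v1, h1, v2, h2, v3, h3, -⟩, h⟩
    refine ⟨v1, v2, v3, h1, h2, h3, ?_⟩
    rw [← h, kdvbOperator, h1.weakDeriv_eq, h2.weakDeriv_eq, h3.weakDeriv_eq, mulOp_apply]
  · rintro ⟨v1, v2, v3, h1, h2, h3, h⟩
    refine ⟨⟨v1, h1, v2, h2, v3, h3, trivial⟩, ?_⟩
    rw [← h, kdvbOperator, h1.weakDeriv_eq, h2.weakDeriv_eq, h3.weakDeriv_eq, mulOp_apply]

/-- The graph of `A v = - v_xxx + v_xx - lam0 v` with domain `H³`. -/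
def kdvbGraph (lam0 : Linf) : Submodule ℝ (L2 × L2) where
  carrier := {p | MemH 3 p.1 ∧ kdvbOperator lam0 p.1 = p.2}
  add_mem' := by
    rintro ⟨v, y⟩ ⟨w, z⟩ hv hw
    obtain ⟨v1, v2, v3, h1, h2, h3, h⟩ := memH_three_and_iff.1 hv
    obtain ⟨w1, w2, w3, k1, k2, k3, k⟩ := memH_three_and_iff.1 hw
    refine memH_three_and_iff.2 ⟨v1 + w1, v2 + w2, v3 + w3, h1.add k1, h2.add k2, h3.add k3, ?_⟩
    simp only [Prod.fst_add, Prod.snd_add, map_add] at h k ⊢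
    rw [← h, ← k]
    abel
  zero_mem' := memH_three_and_iff.2 ⟨0, 0, 0, hasWeakDeriv_zero, hasWeakDeriv_zero,
    hasWeakDeriv_zero, by simp⟩
  smul_mem' := by
    rintro c ⟨v, y⟩ hv
    obtain ⟨v1, v2, v3, h1, h2, h3, h⟩ := memH_three_and_iff.1 hv
    refine memH_three_and_iff.2 ⟨c • v1, c • v2, c • v3, h1.const_smul c, h2.const_smul c,
      h3.const_smul c, ?_⟩
    simp only [Prod.smul_fst, Prod.smul_snd, map_smul] at h ⊢
    rw [← h, smul_sub, smul_add, smul_neg]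

theorem mem_kdvbGraph {lam0 : Linf} {p : L2 × L2} : p ∈ kdvbGraph lam0 ↔
    ∃ v1 v2 v3 : L2, HasWeakDeriv p.1 v1 ∧
      HasWeakDeriv v1 v2 ∧ HasWeakDeriv v2 v3 ∧ - v3 + v2 - mulOp lam0 p.1 = p.2 :=
  memH_three_and_iff

/-- The energy identity of the generator. -/
theorem inner_kdvbGraph {lam0 : Linf} {p : L2 × L2} (hp : p ∈ kdvbGraph lam0) :
    inner ℝ p.2 p.1 = - ‖weakDeriv p.1‖ ^ 2 - inner ℝ (mulOp lam0 p.1) p.1 := by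
  obtain ⟨v1, v2, v3, h1, h2, h3, h⟩ := mem_kdvbGraph.1 hp
  rw [← h, h1.weakDeriv_eq, inner_sub_left, inner_add_left, inner_neg_left]
  -- The dispersive term drops out, −⟨v_xxx, v⟩ = ⟨v_xx, v_x⟩ = 0, while ⟨v_xx, v⟩ = −‖v_x‖².
  have e1 := h3.inner_eq h1
  have e2 := h2.inner_eq h1
  have e3 := h2.inner_self
  rw [real_inner_self_eq_norm_sq] at e2
  rw [real_inner_comm] at e3
  linarith

theorem kdvbGraph_fst_eq_zero {lam0 : Linf} {w : L2} (h : (0, w) ∈ kdvbGraph lam0) : w = 0 := by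
  have h1 := h.2
  have h2 := (kdvbGraph lam0).zero_mem.2
  exact h1.symm.trans h2

theorem mulOp_zero : mulOp 0 = 0 := by
  ext1 v
  exact Lp.zero_smul ℝ ∞ v

theorem isDissipative_kdvbGraph_zero : IsDissipative (kdvbGraph 0) := fun p hp => by
  rw [inner_kdvbGraph hp, mulOp_zero]
  simp

/-- The range condition: `4/27 - ∂² + ∂³ = (∂ + 1/3) (∂ - 2/3)²`. -/
theorem hasFullRange_kdvbGraph_zero : HasFullRange (kdvbGraph 0) (4 / 27) := by
  intro v
  -- The value 4/27 gives x³ − x² + μ a double root at its critical point 2/3. All roots are then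
  -- real and nonzero, so each factor can be inverted in real L².
  obtain ⟨z, z', hz, hzv⟩ := exists_hasWeakDeriv_smul_add (a := 1 / 3) (by norm_num) v
  obtain ⟨y, y', hy, hyz⟩ := exists_hasWeakDeriv_smul_add (a := -2 / 3) (by norm_num) z
  obtain ⟨w, w', hw, hwy⟩ := exists_hasWeakDeriv_smul_add (a := -2 / 3) (by norm_num) y
  have hw' : w' = y + (2 / 3 : ℝ) • w := by rw [← hwy]; module
  have hy' : y' = z + (2 / 3 : ℝ) • y := by rw [← hyz]; module
  have hz' : z' = v - (1 / 3 : ℝ) • z := by rw [← hzv]; module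
  have d2 : HasWeakDeriv w' (y' + (2 / 3 : ℝ) • w') := by
    nth_rw 1 [hw']; exact hy.add (hw.const_smul _)
  have d3 : HasWeakDeriv (y' + (2 / 3 : ℝ) • w')
      ((z' + (2 / 3 : ℝ) • y') + (2 / 3 : ℝ) • (y' + (2 / 3 : ℝ) • w')) := by
    refine HasWeakDeriv.add ?_ (d2.const_smul _)
    nth_rw 1 [hy']; exact hz.add (hy.const_smul _)
  have hmem : (w, -((z' + (2 / 3 : ℝ) • y') + (2 / 3 : ℝ) • (y' + (2 / 3 : ℝ) • w'))
      + (y' + (2 / 3 : ℝ) • w') - mulOp 0 w) ∈ kdvbGraph 0 :=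
    mem_kdvbGraph.2 ⟨w', _, _, hw, d2, d3, rfl⟩
  refine ⟨_, hmem, ?_⟩
  simp only [mulOp_zero, zero_apply]
  rw [hz', hy', hw']
  module

/-- The graph of `A - ‖lam0‖`. -/
def shiftedGraph (lam0 : Linf) : Submodule ℝ (L2 × L2) :=
  (kdvbGraph lam0).comap
    ((LinearMap.fst ℝ L2 L2).prod (LinearMap.snd ℝ L2 L2 + ‖lam0‖ • LinearMap.fst ℝ L2 L2))

theorem mem_shiftedGraph {lam0 : Linf} {p : L2 × L2} :
    p ∈ shiftedGraph lam0 ↔ (p.1, p.2 + ‖lam0‖ • p.1) ∈ kdvbGraph lam0 := Iff.rfl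

theorem isDissipative_shiftedGraph (lam0 : Linf) : IsDissipative (shiftedGraph lam0) := by
  intro p hp
  have h := inner_kdvbGraph (mem_shiftedGraph.1 hp)
  simp only [inner_add_left, real_inner_smul_left, real_inner_self_eq_norm_sq] at h
  have h2 := (abs_le.1 (abs_inner_mulOp_le lam0 p.1 p.1)).1
  nlinarith [sq_nonneg ‖weakDeriv p.1‖]

/-- The shifted operator differs from the case λ₀ = 0 by −λ₀ − ‖λ₀‖, of norm at most 2‖λ₀‖, which is
below the chosen spectral value. -/
theorem hasFullRange_shiftedGraph (lam0 : Linf) :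
    HasFullRange (shiftedGraph lam0) (2 * ‖lam0‖ + 1) := by
  have hpos : 0 < 2 * ‖lam0‖ + 1 := by positivity
  intro v
  obtain ⟨p, hp, h⟩ := isDissipative_kdvbGraph_zero.exists_of_perturbation hpos
    (isDissipative_kdvbGraph_zero.hasFullRange (by norm_num) hasFullRange_kdvbGraph_zero hpos)
    (- mulOp lam0 - ‖lam0‖ • ContinuousLinearMap.id ℝ L2) (by
      refine (norm_sub_le _ _).trans_lt ?_
      rw [norm_neg, norm_smul, norm_norm]
      have h1 := norm_mulOp_le lam0
      have h2 : ‖lam0‖ * ‖ContinuousLinearMap.id ℝ L2‖ ≤ ‖lam0‖ :=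
        mul_le_of_le_one_right (norm_nonneg _) ContinuousLinearMap.norm_id_le
      linarith) v
  refine ⟨(p.1, p.2 + (- mulOp lam0 p.1 - ‖lam0‖ • p.1)), ?_, ?_⟩
  · rw [mem_shiftedGraph]
    obtain ⟨v1, v2, v3, h1, h2, h3, h4⟩ := mem_kdvbGraph.1 hp
    refine mem_kdvbGraph.2 ⟨v1, v2, v3, h1, h2, h3, ?_⟩
    rw [mulOp_zero, zero_apply, sub_zero] at h4
    rw [← h4]
    simp only
    abel
  · rw [← h]
    change _ = (2 * ‖lam0‖ + 1) • p.1 - p.2 - (- mulOp lam0 p.1 - ‖lam0‖ • p.1)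
    simp only
    abel

/-- The operator `A` generates a strongly continuous semigroup. -/
theorem exists_isKdVBSemigroup (lam0 : Linf) :
    ∃ S : ℝ → L2 →L[ℝ] L2, IsKdVBSemigroup lam0 S := by
  obtain ⟨S, h0, hadd, hcont, hgen⟩ := (isDissipative_shiftedGraph lam0).exists_semigroup
    (by positivity) (hasFullRange_shiftedGraph lam0) (fun w hw => by
      have := kdvbGraph_fst_eq_zero (lam0 := lam0) (w := w) (by
        have h1 := mem_shiftedGraph.1 hw
        simpa using h1)
      exact this)
  set c := ‖lam0‖
  have hexp : Tendsto (fun t : ℝ => Real.exp (c * t)) (𝓝[>] 0) (𝓝 1) := by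
    have : Tendsto (fun t : ℝ => Real.exp (c * t)) (𝓝 0) (𝓝 (Real.exp (c * 0))) :=
      (by fun_prop : Continuous fun t : ℝ => Real.exp (c * t)).tendsto 0
    rw [mul_zero, Real.exp_zero] at this
    exact this.mono_left nhdsWithin_le_nhds
  have hexp' : Tendsto (fun t : ℝ => t⁻¹ * (Real.exp (c * t) - 1)) (𝓝[>] 0) (𝓝 c) := by
    have h1 : HasDerivAt (fun t : ℝ => Real.exp (c * t)) (Real.exp (c * 0) * (c * 1)) 0 :=
      ((hasDerivAt_id (0 : ℝ)).const_mul c).exp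
    have h2 := h1.tendsto_slope_zero_right
    simpa using h2
  -- The factor e^{ct} undoes the shift by c = ‖λ₀‖ that made the operator dissipative.
  refine ⟨fun t => Real.exp (c * t) • S t, ⟨⟨?_, fun s t hs ht => ?_, fun v => ?_⟩,
    fun v w => ?_⟩⟩
  · simp [h0]
  · rw [hadd s t hs ht, mul_add, Real.exp_add]
    ext1 v
    simp [smul_smul, mul_comm]
  · simpa using hexp.smul (hcont v)
  · have hiff : (v, w - c • v) ∈ shiftedGraph lam0 ↔ MemH 3 v ∧ kdvbOperator lam0 v = w := by
      rw [mem_shiftedGraph, sub_add_cancel]; rfl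
    rw [← hiff, ← hgen]
    have hsplit : ∀ t : ℝ, t⁻¹ • ((Real.exp (c * t) • S t) v - v)
        = Real.exp (c * t) • t⁻¹ • (S t v - v) + (t⁻¹ * (Real.exp (c * t) - 1)) • v := by
      intro t
      rw [smul_apply]
      module
    constructor
    · intro h
      have h1 := (h.sub (hexp'.smul_const v))
      have h2 := (hexp.inv₀ one_ne_zero).smul h1
      rw [inv_one, one_smul] at h2
      refine h2.congr fun t => ?_
      rw [hsplit, add_sub_cancel_right, smul_smul, inv_mul_cancel₀ (Real.exp_pos _).ne', one_smul]
    · intro h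
      have h1 := (hexp.smul h).add (hexp'.smul_const v)
      rw [one_smul, sub_add_cancel] at h1
      exact h1.congr fun t => (hsplit t).symm

/-! ### Strongly continuous semigroups, Duhamel integrals and the method of steps -/

section Semigroup

variable {S : ℝ → L2 →L[ℝ] L2}

theorem IsC0Semigroup.tendsto_zero_Ici (hS : IsC0Semigroup S) (v : L2) :
    Tendsto (fun t => S t v) (𝓝[≥] 0) (𝓝 v) := by
  have h : ContinuousWithinAt (fun t => S t v) (Ioi 0) 0 := by
    simpa [ContinuousWithinAt, hS.zero] using hS.tendsto_zero v
  have h2 := continuousWithinAt_Ioi_iff_Ici.1 h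
  simpa [ContinuousWithinAt, hS.zero] using h2

/-- Otherwise there are t_n → 0 with ‖S(t_n)‖ > n, although each sequence S(t_n)v converges; this
contradicts the uniform boundedness principle. -/
theorem IsC0Semigroup.exists_bound_near_zero (hS : IsC0Semigroup S) :
    ∃ δ > 0, ∃ M, ∀ t ∈ Icc 0 δ, ‖S t‖ ≤ M := by
  by_contra! hcon
  have hpos : ∀ n : ℕ, (0 : ℝ) < 1 / ((n : ℝ) + 1) := fun n => by positivity
  choose t ht htn using fun n : ℕ => hcon (1 / ((n : ℝ) + 1)) (hpos n) n
  have htend : Tendsto t atTop (𝓝[≥] 0) := by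
    refine tendsto_nhdsWithin_iff.2 ⟨?_, Eventually.of_forall fun n => (ht n).1⟩
    exact squeeze_zero (fun n => (ht n).1) (fun n => (ht n).2)
      tendsto_one_div_add_atTop_nhds_zero_nat
  obtain ⟨C, hC⟩ := banach_steinhaus (g := fun n => S (t n)) fun v => by
    obtain ⟨C, hC⟩ := (Metric.isBounded_range_of_tendsto _
      ((hS.tendsto_zero_Ici v).comp htend)).exists_norm_le
    exact ⟨C, fun n => hC _ ⟨n, rfl⟩⟩
  obtain ⟨n, hn⟩ := exists_nat_gt C
  linarith [hC n, htn n]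

theorem IsC0Semigroup.exists_bound (hS : IsC0Semigroup S) (T : ℝ) :
    ∃ M, 0 ≤ M ∧ ∀ t ∈ Icc 0 T, ‖S t‖ ≤ M := by
  obtain ⟨δ, hδ, M₀, hM₀⟩ := hS.exists_bound_near_zero
  set M := max M₀ 1
  have hM1 : 1 ≤ M := le_max_right _ _
  have hM : ∀ t ∈ Icc 0 δ, ‖S t‖ ≤ M := fun t ht => (hM₀ t ht).trans (le_max_left _ _)
  have key : ∀ n : ℕ, ∀ t ∈ Icc 0 (n * δ), ‖S t‖ ≤ M ^ n * M := by
    intro n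
    induction n with
    | zero =>
      intro t ht
      have ht' : t ∈ Icc 0 δ := ⟨ht.1, by have := ht.2; simp at this; linarith⟩
      rw [pow_zero, one_mul]
      exact hM t ht'
    | succ n ih =>
      intro t ht
      rcases le_total t δ with h | h
      · refine (hM t ⟨ht.1, h⟩).trans ?_
        exact le_mul_of_one_le_left (by positivity) (one_le_pow₀ hM1)
      · have h1 : t - δ ∈ Icc 0 (n * δ) := by
          refine ⟨by linarith, ?_⟩
          have := ht.2
          push_cast at this
          linarith
        have h2 := hS.add δ (t - δ) hδ.le h1.1
        rw [add_sub_cancel] at h2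
        rw [h2, pow_succ']
        refine (ContinuousLinearMap.opNorm_comp_le _ _).trans ?_
        rw [mul_assoc]
        exact mul_le_mul (hM δ ⟨hδ.le, le_rfl⟩) (ih _ h1)
          (norm_nonneg _) (by positivity)
  obtain ⟨n, hn⟩ := exists_nat_gt (T / δ)
  rw [div_lt_iff₀ hδ] at hn
  exact ⟨M ^ n * M, by positivity, fun t ht => key n t ⟨ht.1, ht.2.trans hn.le⟩⟩

theorem IsC0Semigroup.norm_sub_le (hS : IsC0Semigroup S) {T M : ℝ}
    (hM : ∀ t ∈ Icc 0 T, ‖S t‖ ≤ M) {s t : ℝ} (hs : s ∈ Icc 0 T) (ht : t ∈ Icc 0 T) (v : L2) :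
    ‖S t v - S s v‖ ≤ M * ‖S |t - s| v - v‖ := by
  have key : ∀ s ∈ Icc 0 T, ∀ t, s ≤ t → ‖S t v - S s v‖ ≤ M * ‖S (t - s) v - v‖ := by
    intro s hs t hst
    have h := hS.add s (t - s) hs.1 (sub_nonneg.2 hst)
    rw [add_sub_cancel] at h
    rw [h, ContinuousLinearMap.comp_apply, ← map_sub]
    exact (S s).le_of_opNorm_le (hM s hs) _
  rcases le_total s t with h | h
  · rw [abs_of_nonneg (sub_nonneg.2 h)]; exact key s hs t h
  · rw [abs_sub_comm, abs_of_nonneg (sub_nonneg.2 h), norm_sub_rev]; exact key t ht s h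

/-- A strongly continuous semigroup, extended by the identity to negative times, is jointly
continuous. -/
theorem IsC0Semigroup.continuous_uncurry (hS : IsC0Semigroup S) :
    Continuous (fun p : ℝ × L2 => S (max p.1 0) p.2) := by
  rw [continuous_iff_continuousAt]
  rintro ⟨t₀, v₀⟩
  obtain ⟨M, hM0, hM⟩ := hS.exists_bound (max t₀ 0 + 1)
  rw [ContinuousAt, tendsto_iff_norm_sub_tendsto_zero]
  have hr0 : max t₀ 0 ∈ Icc 0 (max t₀ 0 + 1) := ⟨le_max_right _ _, by linarith⟩
  have hcm : Continuous (fun p : ℝ × L2 => max p.1 0) := by fun_prop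
  have hcv : Continuous (fun p : ℝ × L2 => p.2) := by fun_prop
  have hca : Continuous (fun p : ℝ × L2 => |max p.1 0 - max t₀ 0|) := by fun_prop
  have habs : Tendsto (fun p : ℝ × L2 => |max p.1 0 - max t₀ 0|) (𝓝 (t₀, v₀)) (𝓝[≥] 0) := by
    refine tendsto_nhdsWithin_iff.2 ⟨?_, Eventually.of_forall fun p => mem_Ici.2 (abs_nonneg _)⟩
    simpa using hca.tendsto (t₀, v₀)
  have h1 : Tendsto (fun p : ℝ × L2 => M * ‖p.2 - v₀‖
      + M * ‖S |max p.1 0 - max t₀ 0| v₀ - v₀‖) (𝓝 (t₀, v₀)) (𝓝 0) := by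
    have a1 := (((hcv.tendsto (t₀, v₀)).sub_const v₀).norm).const_mul M
    have a2 := ((((hS.tendsto_zero_Ici v₀).comp habs).sub_const v₀).norm).const_mul M
    simpa using a1.add a2
  refine squeeze_zero' (Eventually.of_forall fun _ => norm_nonneg _) ?_ h1
  have hev : ∀ᶠ p in 𝓝 (t₀, v₀), max p.1 0 < max t₀ 0 + 1 :=
    (hcm.tendsto (t₀, v₀)).eventually (gt_mem_nhds (by simp))
  filter_upwards [hev] with p hp
  have hpr : max p.1 0 ∈ Icc 0 (max t₀ 0 + 1) := ⟨le_max_right _ _, hp.le⟩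
  calc ‖S (max p.1 0) p.2 - S (max t₀ 0) v₀‖
      = ‖S (max p.1 0) (p.2 - v₀) + (S (max p.1 0) v₀ - S (max t₀ 0) v₀)‖ := by
        rw [map_sub]; congr 1; abel
    _ ≤ _ := norm_add_le _ _
    _ ≤ _ := add_le_add ((S _).le_of_opNorm_le (hM _ hpr) _) (hS.norm_sub_le hM hr0 hpr v₀)

theorem IsC0Semigroup.continuous_apply (hS : IsC0Semigroup S) (v : L2) :
    Continuous (fun t : ℝ => S (max t 0) v) :=
  hS.continuous_uncurry.comp (by fun_prop : Continuous fun t : ℝ => (t, v))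

theorem IsC0Semigroup.aestronglyMeasurable_comp (hS : IsC0Semigroup S) {α : Type*}
    [MeasurableSpace α] {μ : Measure α} {r : α → ℝ} {g : α → L2} (hr : Measurable r)
    (hg : AEStronglyMeasurable g μ) :
    AEStronglyMeasurable (fun a => S (max (r a) 0) (g a)) μ :=
  hS.continuous_uncurry.comp_aestronglyMeasurable
    (hr.aestronglyMeasurable.prodMk hg)

/-- The Duhamel integral `∫₀ᵗ S(t - s) g(s) ds`, extended by `0` to negative times. -/
def duhamel (S : ℝ → L2 →L[ℝ] L2) (g : ℝ → L2) (t : ℝ) : L2 :=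
  ∫ s in Ioi 0, (Iio t).indicator (fun s => S (max (t - s) 0) (g s)) s

theorem duhamel_of_nonpos (S : ℝ → L2 →L[ℝ] L2) (g : ℝ → L2) {t : ℝ} (ht : t ≤ 0) :
    duhamel S g t = 0 := by
  rw [duhamel]
  refine (setIntegral_congr_fun (g := fun _ => 0) measurableSet_Ioi fun s hs => ?_).trans
    (integral_zero _ _)
  have hst : s ∉ Iio t := fun h => absurd (lt_trans (mem_Ioi.1 hs) (mem_Iio.1 h)) (not_lt.2 ht)
  exact indicator_of_notMem hst _

theorem duhamel_eq (S : ℝ → L2 →L[ℝ] L2) (g : ℝ → L2) {t : ℝ} (ht : 0 ≤ t) :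
    duhamel S g t = ∫ s in 0..t, S (t - s) (g s) := by
  rw [duhamel, setIntegral_indicator measurableSet_Iio, Ioi_inter_Iio,
    intervalIntegral.integral_of_le ht, integral_Ioc_eq_integral_Ioo]
  refine setIntegral_congr_fun measurableSet_Ioo fun s hs => ?_
  rw [max_eq_left (sub_nonneg.2 hs.2.le)]

theorem duhamel_congr (S : ℝ → L2 →L[ℝ] L2) {g g' : ℝ → L2} {t : ℝ}
    (h : ∀ s, 0 < s → s < t → g s = g' s) : duhamel S g t = duhamel S g' t := by
  refine setIntegral_congr_fun measurableSet_Ioi fun s hs => ?_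
  by_cases hst : s < t
  · simp only [indicator_of_mem (show s ∈ Iio t from hst), h s hs hst]
  · simp only [indicator_of_notMem (show s ∉ Iio t from hst)]

/-- The indicator keeps the domain of integration independent of t, so dominated convergence
applies. For fixed s the integrand can jump only at t = s, which excludes a null set of s. -/
theorem IsC0Semigroup.continuous_duhamel (hS : IsC0Semigroup S) {g : ℝ → L2}
    (hg : LocallyIntegrable g volume) : Continuous (duhamel S g) := by
  rw [continuous_iff_continuousAt]
  intro t₀
  obtain ⟨M, hM0, hM⟩ := hS.exists_bound (t₀ + 1)
  have hgi : IntegrableOn g (Ioc 0 (t₀ + 1)) :=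
    (hg.integrableOn_isCompact isCompact_Icc).mono_set Ioc_subset_Icc_self
  refine continuousAt_of_dominated (bound := (Ioc 0 (t₀ + 1)).indicator fun s => M * ‖g s‖)
    (Eventually.of_forall fun t => ?_) ?_ ?_ ?_
  · refine AEStronglyMeasurable.indicator ?_ measurableSet_Iio
    exact hS.aestronglyMeasurable_comp (by fun_prop) hg.aestronglyMeasurable.restrict
  · filter_upwards [gt_mem_nhds (lt_add_one t₀)] with t ht
    refine (ae_restrict_iff' measurableSet_Ioi).2 (Eventually.of_forall fun s hs => ?_)
    by_cases hst : s < t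
    · have hs0 : 0 < s := hs
      rw [indicator_of_mem (show s ∈ Iio t from hst),
        indicator_of_mem (show s ∈ Ioc 0 (t₀ + 1) from ⟨hs, (hst.trans ht).le⟩)]
      refine (S _).le_of_opNorm_le (hM _ ⟨le_max_right _ _, ?_⟩) _
      exact max_le (by linarith) (by linarith)
    · rw [indicator_of_notMem (show s ∉ Iio t from hst), norm_zero]
      exact indicator_nonneg (fun _ _ => by positivity) _
  · refine IntegrableOn.integrable_indicator ?_ measurableSet_Ioc |>.integrableOn
    exact hgi.norm.const_mul M
  · refine ae_restrict_of_ae ?_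
    have : ∀ᵐ s : ℝ, s ≠ t₀ := by simp [ae_iff]
    filter_upwards [this] with s hs
    rcases lt_or_gt_of_ne hs with h | h
    · have hev : (fun t => S (max (t - s) 0) (g s)) =ᶠ[𝓝 t₀]
          fun t => (Iio t).indicator (fun s => S (max (t - s) 0) (g s)) s := by
        filter_upwards [lt_mem_nhds h] with t ht
        rw [indicator_of_mem (show s ∈ Iio t from ht)]
      refine ContinuousAt.congr ?_ hev
      exact ((hS.continuous_apply (g s)).comp (by fun_prop : Continuous fun t => t - s)).continuousAt
    · have hev : (fun _ => (0 : L2)) =ᶠ[𝓝 t₀]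
          fun t => (Iio t).indicator (fun s => S (max (t - s) 0) (g s)) s := by
        filter_upwards [gt_mem_nhds h] with t ht
        rw [indicator_of_notMem (show s ∉ Iio t from not_lt.2 (le_of_lt ht))]
      exact continuousAt_const.congr hev

/-- One step of the method of steps for the delayed equation. -/
def mildMap (S : ℝ → L2 →L[ℝ] L2) (lam : Linf) (τ : ℝ) (u₀ f w : ℝ → L2) (t : ℝ) : L2 :=
  u₀ t - u₀ 0 + S (max t 0) (u₀ 0) - duhamel S (fun s => mulOp lam (w (s - τ))) t + duhamel S f t

theorem IsC0Semigroup.continuous_mildMap (hS : IsC0Semigroup S) (lam : Linf) (τ : ℝ)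
    {u₀ f w : ℝ → L2} (hu₀ : Continuous u₀) (hf : LocallyIntegrable f volume)
    (hw : Continuous w) : Continuous (mildMap S lam τ u₀ f w) := by
  have h1 := hS.continuous_apply (u₀ 0)
  have h2 : Continuous fun s => mulOp lam (w (s - τ)) := by fun_prop
  have h3 := hS.continuous_duhamel (h2.locallyIntegrable (μ := volume))
  have h4 := hS.continuous_duhamel hf
  exact (((hu₀.sub continuous_const).add h1).sub h3).add h4

/-- The summand u₀(t) − u₀(0) lets one formula serve both ranges: it restores the history for t ≤ 0
and vanishes for t ≥ 0 once u₀ is extended by a constant. -/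
theorem mildMap_of_nonpos (hS : IsC0Semigroup S) (lam : Linf) (τ : ℝ) (u₀ f w : ℝ → L2) {t : ℝ}
    (ht : t ≤ 0) : mildMap S lam τ u₀ f w t = u₀ t := by
  simp [mildMap, duhamel_of_nonpos S _ ht, max_eq_right ht, hS.zero]

/-- The map evaluated at t reads its argument only before t − τ. So the n-th iterate is already
stationary up to time nτ, and finitely many iterations give an exact fixed point on (−∞, T]. -/
theorem exists_mildMap_fixed (hS : IsC0Semigroup S) (lam : Linf) {τ : ℝ} (hτ : 0 < τ) (T : ℝ)
    {u₀ f : ℝ → L2} (hu₀ : Continuous u₀) (hf : LocallyIntegrable f volume) :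
    ∃ u : ℝ → L2, Continuous u ∧ ∀ t ≤ T, u t = mildMap S lam τ u₀ f u t := by
  let Φ := mildMap S lam τ u₀ f
  have hcont : ∀ n : ℕ, Continuous (Φ^[n] u₀) := by
    intro n
    induction n with
    | zero => exact hu₀
    | succ n ih =>
      rw [Function.iterate_succ_apply']
      exact hS.continuous_mildMap lam τ hu₀ hf ih
  have hstab : ∀ n : ℕ, ∀ t ≤ n * τ, (Φ^[n] u₀) t = (Φ^[n + 1] u₀) t := by
    intro n
    induction n with
    | zero =>
      intro t ht
      have ht' : t ≤ 0 := by simpa using ht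
      exact (mildMap_of_nonpos hS lam τ u₀ f u₀ ht').symm
    | succ n ih =>
      intro t ht
      rw [Function.iterate_succ_apply', Function.iterate_succ_apply' Φ (n + 1)]
      change mildMap S lam τ u₀ f _ t = mildMap S lam τ u₀ f _ t
      unfold mildMap
      congr 2
      refine duhamel_congr S fun s _ hs => ?_
      rw [ih]
      push_cast at ht
      linarith
  obtain ⟨n, hn⟩ := exists_nat_gt (T / τ)
  rw [div_lt_iff₀ hτ] at hn
  refine ⟨Φ^[n] u₀, hcont n, fun t ht => ?_⟩
  rw [hstab n t (ht.trans hn.le), Function.iterate_succ_apply']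

theorem exists_isMildSolution (hS : IsC0Semigroup S) (lam : Linf) {τ : ℝ} (hτ : 0 < τ) (T : ℝ)
    {u₀ f : ℝ → L2} (hu₀ : ContinuousOn u₀ (Icc (-τ) 0)) (hf : IntegrableOn f (Ioo 0 T)) :
    ∃ u : ℝ → L2, Continuous u ∧ IsMildSolution S lam τ T u₀ f u := by
  have hτ' : -τ ≤ 0 := by linarith
  -- The history is extended by constants and f by zero, so that every function lives on ℝ and u is
  -- continuous everywhere.
  let v₀ : ℝ → L2 := IccExtend hτ' ((Icc (-τ) 0).domRestrict u₀)
  have hv₀ : Continuous v₀ := hu₀.domRestrict.Icc_extend'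
  have hv : ∀ s ∈ Icc (-τ) 0, v₀ s = u₀ s := fun s hs => IccExtend_of_mem hτ' _ hs
  have hv0 : v₀ 0 = u₀ 0 := hv 0 ⟨hτ', le_rfl⟩
  have hf' : LocallyIntegrable ((Ioo 0 T).indicator f) volume :=
    (hf.integrable_indicator measurableSet_Ioo).locallyIntegrable
  obtain ⟨u, hu, hfix⟩ := exists_mildMap_fixed hS lam hτ (max T 0) hv₀ hf'
  refine ⟨u, hu, hu.continuousOn, fun s hs => ?_, fun t ht => ?_⟩
  · rw [hfix s (hs.2.trans (le_max_right _ _)), mildMap_of_nonpos hS lam τ _ _ _ hs.2, hv s hs]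
  · have hvt : v₀ t = v₀ 0 := by
      simp only [v₀]
      rw [IccExtend_of_right_le hτ' _ ht.1, IccExtend_of_right_le hτ' _ le_rfl]
    have hd : duhamel S ((Ioo 0 T).indicator f) t = duhamel S f t :=
      duhamel_congr S fun s h0 hs => indicator_of_mem (s := Ioo 0 T) ⟨h0, hs.trans_le ht.2⟩ f
    rw [hfix t (ht.2.trans (le_max_left _ _)), mildMap, hvt, sub_self, zero_add, hv0,
      max_eq_left ht.1, hd, duhamel_eq S _ ht.1, duhamel_eq S _ ht.1]
    rfl

/-- Agreement up to nτ makes the delay terms agree up to (n + 1)τ, and the right-hand side of the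
mild formula involves u only through its history and that term. -/
theorem IsMildSolution.eqOn {lam : Linf} {τ T : ℝ} (hτ : 0 < τ) {u₀ f u v : ℝ → L2}
    (hu : IsMildSolution S lam τ T u₀ f u) (hv : IsMildSolution S lam τ T u₀ f v) :
    EqOn v u (Icc (-τ) T) := by
  have key : ∀ n : ℕ, ∀ t ∈ Icc (-τ) T, t ≤ n * τ → v t = u t := by
    intro n
    induction n with
    | zero =>
      intro t ht htn
      have ht' : t ∈ Icc (-τ) 0 := ⟨ht.1, by simpa using htn⟩
      rw [hu.history t ht', hv.history t ht']
    | succ n ih =>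
      intro t ht htn
      rcases le_total t 0 with h | h
      · rw [hu.history t ⟨ht.1, h⟩, hv.history t ⟨ht.1, h⟩]
      · rw [hu.formula t ⟨h, ht.2⟩, hv.formula t ⟨h, ht.2⟩]
        congr 2
        refine intervalIntegral.integral_congr fun s hs => ?_
        rw [uIcc_of_le h] at hs
        rw [ih (s - τ) ⟨by linarith [hs.1], by linarith [hs.2, ht.2]⟩]
        push_cast at htn
        linarith [hs.2]
  intro t ht
  obtain ⟨n, hn⟩ := exists_nat_gt (T / τ)
  rw [div_lt_iff₀ hτ] at hn
  exact key n t ht (ht.2.trans hn.le)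

end Semigroup

/-! ### The chain rule for the squared norm of a primitive -/

section NormSq

variable {H : Type*} [NormedAddCommGroup H] [InnerProductSpace ℝ H] [CompleteSpace H]

theorem norm_sq_add_integral_of_continuous {G : ℝ → H} (hG : Continuous G) (w : H) (t : ℝ) :
    ‖w + ∫ s in 0..t, G s‖ ^ 2
      = ‖w‖ ^ 2 + 2 * ∫ s in 0..t, inner ℝ (G s) (w + ∫ r in 0..s, G r) := by
  have hd : ∀ t, HasDerivAt (fun t => w + ∫ s in 0..t, G s) (G t) t := fun t =>
    (hG.integral_hasStrictDerivAt 0 t).hasDerivAt.const_add w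
  have hc : Continuous (fun t => w + ∫ s in 0..t, G s) :=
    continuous_iff_continuousAt.2 fun t => (hd t).continuousAt
  have h := intervalIntegral.integral_eq_sub_of_hasDerivAt (a := 0) (b := t)
    (fun s _ => (hd s).norm_sq) ((by fun_prop : Continuous fun s =>
      2 * inner ℝ (w + ∫ r in 0..s, G r) (G s)).intervalIntegrable 0 t)
  simp only [intervalIntegral.integral_same, add_zero] at h
  rw [intervalIntegral.integral_const_mul] at h
  simp only [real_inner_comm] at h ⊢
  linarith

theorem norm_intervalIntegral_le_integral_norm {E : Type*} [NormedAddCommGroup E] [NormedSpace ℝ E]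
    {G : ℝ → E} (hG : Integrable G) {t : ℝ} (ht : 0 ≤ t) :
    ‖∫ s in 0..t, G s‖ ≤ ∫ s, ‖G s‖ := by
  rw [intervalIntegral.integral_of_le ht]
  refine (norm_integral_le_integral_norm _).trans ?_
  exact setIntegral_le_integral hG.norm (Eventually.of_forall fun _ => norm_nonneg _)

/-- Continuous functions approximate G in L¹, their primitives then converge uniformly for t ≥ 0,
and both sides of the continuous case pass to the limit. -/
theorem norm_sq_add_integral_of_integrable {G : ℝ → H} (hG : Integrable G) (w : H) {t : ℝ}
    (ht : 0 ≤ t) : ‖w + ∫ s in 0..t, G s‖ ^ 2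
      = ‖w‖ ^ 2 + 2 * ∫ s in 0..t, inner ℝ (G s) (w + ∫ r in 0..s, G r) := by
  have hpos : ∀ n : ℕ, (0 : ℝ) < 1 / ((n : ℝ) + 1) := fun n => by positivity
  choose F hFs hFG hFc hFi using fun n : ℕ =>
    hG.exists_hasCompactSupport_integral_sub_le (hpos n)
  have hFi' : ∀ n, ∀ a b, IntervalIntegrable (F n) volume a b := fun n a b =>
    (hFc n).intervalIntegrable a b
  have hGi : ∀ a b, IntervalIntegrable G volume a b := fun a b => hG.intervalIntegrable
  let W : ℝ → H := fun t => w + ∫ s in 0..t, G s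
  let V : ℕ → ℝ → H := fun n t => w + ∫ s in 0..t, F n s
  have hWc : Continuous W := continuous_const.add (intervalIntegral.continuous_primitive hGi 0)
  have hVc : ∀ n, Continuous (V n) := fun n =>
    continuous_const.add (intervalIntegral.continuous_primitive (hFi' n) 0)
  have hVW : ∀ n, ∀ s, 0 ≤ s → ‖V n s - W s‖ ≤ 1 / ((n : ℝ) + 1) := by
    intro n s hs
    have e : V n s - W s = - ∫ r in 0..s, (G r - F n r) := by
      rw [intervalIntegral.integral_sub (hGi 0 s) (hFi' n 0 s)]
      simp only [V, W]; abel
    rw [e, norm_neg]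
    exact (norm_intervalIntegral_le_integral_norm (hG.sub (hFi n)) hs).trans (hFG n)
  obtain ⟨K, hK⟩ : ∃ K, ∀ s ∈ Icc 0 t, ‖W s‖ ≤ K :=
    isCompact_Icc.exists_bound_of_continuousOn hWc.continuousOn
  have hlim := tendsto_one_div_add_atTop_nhds_zero_nat (𝕜 := ℝ)
  have hVt : ∀ s, 0 ≤ s → Tendsto (fun n => V n s) atTop (𝓝 (W s)) := fun s hs => by
    rw [tendsto_iff_norm_sub_tendsto_zero]
    exact squeeze_zero (fun _ => norm_nonneg _) (fun n => hVW n s hs) hlim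
  have hint1 : ∀ n, IntervalIntegrable (fun s => inner ℝ (F n s) (V n s)) volume 0 t := fun n =>
    ((hFc n).inner (hVc n)).intervalIntegrable 0 t
  have hbdi : ∀ {X : ℝ → H} {Y : ℝ → H}, Integrable X → Continuous Y →
      IntervalIntegrable (fun s => inner ℝ (X s) (Y s)) volume 0 t := by
    intro X Y hX hY
    rw [intervalIntegrable_iff_integrableOn_Icc_of_le ht]
    obtain ⟨C, hC⟩ := isCompact_Icc.exists_bound_of_continuousOn (s := Icc 0 t) hY.continuousOn
    refine Integrable.mono' (g := fun s => ‖X s‖ * C) (hX.norm.mul_const C).integrableOn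
      ((hX.1.inner hY.aestronglyMeasurable).restrict) ?_
    refine (ae_restrict_iff' measurableSet_Icc).2 (Eventually.of_forall fun s hs => ?_)
    exact (norm_inner_le_norm _ _).trans (mul_le_mul_of_nonneg_left (hC s hs) (norm_nonneg _))
  have hInt : Tendsto (fun n => ∫ s in 0..t, inner ℝ (F n s) (V n s)) atTop
      (𝓝 (∫ s in 0..t, inner ℝ (G s) (W s))) := by
    rw [tendsto_iff_norm_sub_tendsto_zero]
    refine squeeze_zero (fun _ => norm_nonneg _)
      (g := fun n : ℕ => 1 / ((n : ℝ) + 1) * (K + 1) + (∫ s, ‖G s‖) * (1 / ((n : ℝ) + 1)))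
      (fun n => ?_) ?_
    · rw [← intervalIntegral.integral_sub (hint1 n) (hbdi hG hWc)]
      have hi : IntervalIntegrable
          (fun s => ‖G s - F n s‖ * (K + 1) + ‖G s‖ * (1 / ((n : ℝ) + 1))) volume 0 t :=
        (((hG.sub (hFi n)).norm.mul_const _).add (hG.norm.mul_const _)).intervalIntegrable
      refine (intervalIntegral.norm_integral_le_of_norm_le ht ?_ hi).trans ?_
      · refine Eventually.of_forall fun s hs => ?_
        have h0 : 0 ≤ s := hs.1.le
        have h1 : 1 / ((n : ℝ) + 1) ≤ 1 := by
          rw [div_le_one (by positivity)]; linarith [(Nat.cast_nonneg n : (0 : ℝ) ≤ n)]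
        have h2 : ‖V n s‖ ≤ K + 1 := by
          have := hK s ⟨h0, hs.2⟩
          have h3 := hVW n s h0
          calc ‖V n s‖ = ‖W s + (V n s - W s)‖ := by congr 1; abel
            _ ≤ ‖W s‖ + ‖V n s - W s‖ := norm_add_le _ _
            _ ≤ K + 1 := by linarith
        -- The first term is small in L¹ against a bounded factor, the second uniformly small
        -- against the integrable ‖G‖.
        have e : inner ℝ (F n s) (V n s) - inner ℝ (G s) (W s)
            = - inner ℝ (G s - F n s) (V n s) + inner ℝ (G s) (V n s - W s) := by
          rw [inner_sub_left, inner_sub_right]; ring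
        rw [e]
        refine (norm_add_le _ _).trans (add_le_add ?_ ?_)
        · rw [norm_neg]
          exact (norm_inner_le_norm _ _).trans (mul_le_mul_of_nonneg_left h2 (norm_nonneg _))
        · exact (norm_inner_le_norm _ _).trans
            (mul_le_mul_of_nonneg_left (hVW n s h0) (norm_nonneg _))
      · have i1 : Integrable (fun s => ‖G s - F n s‖ * (K + 1)) :=
          (hG.sub (hFi n)).norm.mul_const _
        have i2 : Integrable (fun s => ‖G s‖ * (1 / ((n : ℝ) + 1))) := hG.norm.mul_const _
        have hK0 : 0 ≤ K := (norm_nonneg _).trans (hK 0 ⟨le_rfl, ht⟩)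
        rw [intervalIntegral.integral_of_le ht]
        refine (setIntegral_le_integral (i1.add i2)
          (Eventually.of_forall fun s => ?_)).trans ?_
        · simp only [Pi.add_apply, Pi.zero_apply]; positivity
        · simp only [Pi.add_apply]
          rw [integral_add i1 i2, integral_mul_const, integral_mul_const]
          gcongr
          exact hFG n
    · simpa using (hlim.mul_const (K + 1)).add (hlim.const_mul (∫ s, ‖G s‖))
  have hl : Tendsto (fun n => ‖V n t‖ ^ 2) atTop (𝓝 (‖W t‖ ^ 2)) := (hVt t ht).norm.pow 2
  have hr : Tendsto (fun n => ‖w‖ ^ 2 + 2 * ∫ s in 0..t, inner ℝ (F n s) (V n s)) atTop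
      (𝓝 (‖w‖ ^ 2 + 2 * ∫ s in 0..t, inner ℝ (G s) (W s))) := (hInt.const_mul 2).const_add _
  exact tendsto_nhds_unique hl (hr.congr fun n =>
    (norm_sq_add_integral_of_continuous (hFc n) w t).symm)

/-- The chain rule for `‖U‖²` when `U` is a primitive of an integrable function. -/
theorem norm_sq_eq_of_eq_integral {U G : ℝ → H} {T : ℝ} (hG : LocallyIntegrable G)
    (hU : ∀ t ∈ Icc 0 T, U t = U 0 + ∫ s in 0..t, G s) {t : ℝ} (ht : t ∈ Icc 0 T) :
    ‖U t‖ ^ 2 = ‖U 0‖ ^ 2 + 2 * ∫ s in 0..t, inner ℝ (G s) (U s) := by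
  have hGi : Integrable ((Ioc 0 T).indicator G) :=
    ((hG.integrableOn_isCompact isCompact_Icc).mono_set Ioc_subset_Icc_self).integrable_indicator
      measurableSet_Ioc
  have e : ∀ t ∈ Icc 0 T, U t = U 0 + ∫ s in 0..t, (Ioc 0 T).indicator G s := by
    intro t ht
    rw [hU t ht]
    congr 1
    refine intervalIntegral.integral_congr_ae (Eventually.of_forall fun s hs => ?_)
    rw [uIoc_of_le ht.1] at hs
    rw [indicator_of_mem (show s ∈ Ioc 0 T from ⟨hs.1, hs.2.trans ht.2⟩)]
  rw [e t ht, norm_sq_add_integral_of_integrable hGi _ ht.1]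
  congr 2
  refine intervalIntegral.integral_congr_ae (Eventually.of_forall fun s hs => ?_)
  rw [uIoc_of_le ht.1] at hs
  rw [indicator_of_mem (show s ∈ Ioc 0 T from ⟨hs.1, hs.2.trans ht.2⟩),
    ← e s ⟨hs.1.le, hs.2.trans ht.2⟩]

end NormSq

/-! ### Regularization by averaging the semigroup -/

section Regularization

variable {S : ℝ → L2 →L[ℝ] L2}

theorem IsC0Semigroup.intervalIntegrable (hS : IsC0Semigroup S) (v : L2) (a b : ℝ) :
    IntervalIntegrable (fun s => S (max s 0) v) volume a b :=
  (hS.continuous_apply v).intervalIntegrable a b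

theorem IsC0Semigroup.apply_integral (hS : IsC0Semigroup S) (v : L2) {t h : ℝ} (ht : 0 ≤ t)
    (hh : 0 ≤ h) :
    S t (∫ s in 0..h, S (max s 0) v) = ∫ s in t..(t + h), S (max s 0) v := by
  rw [← ContinuousLinearMap.intervalIntegral_comp_comm _ (hS.intervalIntegrable v 0 h)]
  have := intervalIntegral.integral_comp_add_left (a := 0) (b := h)
    (fun s => S (max s 0) v) t
  rw [add_zero] at this
  rw [← this]
  refine intervalIntegral.integral_congr fun s hs => ?_
  rw [uIcc_of_le hh] at hs
  change S t (S (max s 0) v) = S (max (t + s) 0) v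
  rw [max_eq_left hs.1, max_eq_left (add_nonneg ht hs.1), hS.add t s ht hs.1]
  rfl

/-- The averages `J v = h⁻¹ ∫₀ʰ S(s) v ds` and the operators `B = h⁻¹ (S(h) - 1)`. -/
theorem IsC0Semigroup.exists_regularization (hS : IsC0Semigroup S) :
    ∃ J B : ℕ → L2 →L[ℝ] L2, ∃ C : ℝ, 0 ≤ C ∧ (∀ n v, ‖J n v‖ ≤ C * ‖v‖) ∧
      (∀ v, Tendsto (fun n => J n v) atTop (𝓝 v)) ∧
      (∀ n v, Tendsto (fun t : ℝ => t⁻¹ • (S t (J n v) - J n v)) (𝓝[>] 0) (𝓝 (B n v))) ∧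
      ∀ n v t, 0 ≤ t → J n (S t v) = J n v + ∫ s in 0..t, B n (S (max s 0) v) := by
  obtain ⟨C, hC0, hC⟩ := hS.exists_bound 1
  let h : ℕ → ℝ := fun n => 1 / ((n : ℝ) + 1)
  have hh : ∀ n, 0 < h n := fun n => by simp only [h]; positivity
  have hh1 : ∀ n, h n ≤ 1 := fun n => by
    simp only [h]
    rw [div_le_one (by positivity)]; linarith [(Nat.cast_nonneg n : (0 : ℝ) ≤ n)]
  have hi := hS.intervalIntegrable
  let F : L2 → ℝ → L2 := fun v t => ∫ s in 0..t, S (max s 0) v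
  have hF : ∀ v t, HasDerivAt (F v) (S (max t 0) v) t := fun v t =>
    ((hS.continuous_apply v).integral_hasStrictDerivAt 0 t).hasDerivAt
  have hF0 : ∀ v, F v 0 = 0 := fun v => intervalIntegral.integral_same
  have hbd : ∀ n v, ‖(h n)⁻¹ • F v (h n)‖ ≤ C * ‖v‖ := fun n v => by
    have : ‖F v (h n)‖ ≤ C * ‖v‖ * |h n - 0| :=
      intervalIntegral.norm_integral_le_of_norm_le_const fun s hs => by
        rw [uIoc_of_le (hh n).le] at hs
        rw [max_eq_left hs.1.le]
        exact (S s).le_of_opNorm_le (hC s ⟨hs.1.le, hs.2.trans (hh1 n)⟩) v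
    rw [sub_zero, abs_of_pos (hh n)] at this
    rw [norm_smul, norm_inv, Real.norm_of_nonneg (hh n).le, inv_mul_le_iff₀ (hh n), mul_comm (h n)]
    exact this
  let J : ℕ → L2 →L[ℝ] L2 := fun n => LinearMap.mkContinuous
    { toFun := fun v => (h n)⁻¹ • F v (h n)
      map_add' := fun v w => by
        simp only [F, map_add]
        rw [intervalIntegral.integral_add (hi v _ _) (hi w _ _), smul_add]
      map_smul' := fun c v => by
        simp only [F, map_smul, RingHom.id_apply]
        rw [intervalIntegral.integral_smul, smul_comm] } C (hbd n)
  have hJ : ∀ n v, J n v = (h n)⁻¹ • F v (h n) := fun n v => rfl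
  let B : ℕ → L2 →L[ℝ] L2 := fun n => (h n)⁻¹ • (S (h n) - ContinuousLinearMap.id ℝ L2)
  have hB : ∀ n v, B n v = (h n)⁻¹ • (S (h n) v - v) := fun n v => rfl
  -- The right side is symmetric in h and t. Divided by t as t → 0 it identifies the generator on J
  -- v; with h fixed it gives the integral formula for J S(t) v.
  have hshift : ∀ n v t, 0 ≤ t → S t (F v (h n)) - F v (h n)
      = (F v (h n + t) - F v (h n)) - F v t := by
    intro n v t ht
    simp only [F]
    rw [hS.apply_integral v ht (hh n).le, ← intervalIntegral.integral_interval_sub_left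
      (hi v 0 (t + h n)) (hi v 0 t), add_comm t]
    abel
  refine ⟨J, B, C, hC0, hbd, fun v => ?_, fun n v => ?_, fun n v t ht => ?_⟩
  · have h1 := (hF v 0).tendsto_slope_zero_right
    rw [max_self, hS.zero] at h1
    have h2 : Tendsto h atTop (𝓝[>] 0) := tendsto_nhdsWithin_iff.2
      ⟨tendsto_one_div_add_atTop_nhds_zero_nat, Eventually.of_forall hh⟩
    refine (h1.comp h2).congr fun n => ?_
    simp [hJ, hF0]
  · have h1 := (hF v (h n)).tendsto_slope_zero_right
    have h2 := (hF v 0).tendsto_slope_zero_right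
    rw [max_self, hS.zero] at h2
    rw [max_eq_left (hh n).le] at h1
    have h3 := (h1.sub h2).const_smul (h n)⁻¹
    rw [hB]
    refine h3.congr' ?_
    filter_upwards [self_mem_nhdsWithin] with t ht
    have ht0 : (0 : ℝ) ≤ t := le_of_lt ht
    rw [hJ, map_smul, zero_add, hF0, sub_zero, ← smul_sub t⁻¹, ← smul_sub (h n)⁻¹ (S t _),
      hshift n v t ht0, smul_comm]
  · have h1 : ∀ s ∈ uIcc 0 t, B n (S (max s 0) v)
        = (h n)⁻¹ • (S (max (h n + s) 0) v - S (max s 0) v) := by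
      intro s hs
      rw [uIcc_of_le ht] at hs
      rw [hB, max_eq_left hs.1, max_eq_left (add_nonneg (hh n).le hs.1),
        hS.add (h n) s (hh n).le hs.1]
      rfl
    have hi2 : IntervalIntegrable (fun s => S (max (h n + s) 0) v) volume 0 t :=
      ((hS.continuous_apply v).comp (continuous_const_add (h n))).intervalIntegrable 0 t
    rw [intervalIntegral.integral_congr h1, intervalIntegral.integral_smul,
      intervalIntegral.integral_sub hi2 (hi v 0 t), intervalIntegral.integral_comp_add_left (fun s => S (max s 0) v) (h n),
      add_zero, ← intervalIntegral.integral_interval_sub_left (hi v 0 _) (hi v 0 _)]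
    have h2 : J n (S t v) = S t (J n v) := by
      rw [hJ, hJ, map_smul]
      congr 1
      simp only [F]
      rw [← ContinuousLinearMap.intervalIntegral_comp_comm _ (hi v 0 (h n))]
      refine intervalIntegral.integral_congr fun s hs => ?_
      rw [uIcc_of_le (hh n).le] at hs
      change S (max s 0) (S t v) = S t (S (max s 0) v)
      rw [max_eq_left hs.1, ← ContinuousLinearMap.comp_apply, ← ContinuousLinearMap.comp_apply,
        ← hS.add s t hs.1 ht, ← hS.add t s ht hs.1, add_comm]
    have h3 := hshift n v t ht
    rw [h2, ← sub_eq_iff_eq_add', hJ, map_smul, ← smul_sub, h3]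

end Regularization

/-! ### The energy identity for regularized solutions -/

section Energy

variable {S : ℝ → L2 →L[ℝ] L2} {lam0 : Linf}

theorem IsC0Semigroup.intervalIntegrable_duhamel (hS : IsC0Semigroup S) {g : ℝ → L2}
    (hg : LocallyIntegrable g volume) {t : ℝ} (ht : 0 ≤ t) :
    IntervalIntegrable (fun s => S (t - s) (g s)) volume 0 t := by
  obtain ⟨M, hM0, hM⟩ := hS.exists_bound t
  rw [intervalIntegrable_iff_integrableOn_Icc_of_le ht]
  have hgi : IntegrableOn (fun s => M * ‖g s‖) (Icc 0 t) :=
    ((hg.integrableOn_isCompact isCompact_Icc).norm.const_mul M)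
  refine Integrable.mono' hgi ?_ ?_
  · refine (hS.aestronglyMeasurable_comp (r := fun s => t - s) (by fun_prop)
      hg.aestronglyMeasurable.restrict).congr ?_
    refine (ae_restrict_iff' measurableSet_Icc).2 (Eventually.of_forall fun s hs => ?_)
    simp only
    rw [max_eq_left (sub_nonneg.2 hs.2)]
  · refine (ae_restrict_iff' measurableSet_Icc).2 (Eventually.of_forall fun s hs => ?_)
    exact (S _).le_of_opNorm_le (hM _ ⟨sub_nonneg.2 hs.2, by linarith [hs.1]⟩) _

/-- `J` maps into the domain of the generator `A`, `B = A J` is bounded, and `J` commutes with the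
semigroup. -/
structure IsRegularizer (lam0 : Linf) (S : ℝ → L2 →L[ℝ] L2) (J B : L2 →L[ℝ] L2) : Prop where
  mem : ∀ v, (J v, B v) ∈ kdvbGraph lam0
  comm : ∀ v t, 0 ≤ t → J (S t v) = J v + ∫ s in 0..t, B (S (max s 0) v)

theorem IsRegularizer.sub (hS : IsC0Semigroup S) {J B J' B' : L2 →L[ℝ] L2}
    (h : IsRegularizer lam0 S J B) (h' : IsRegularizer lam0 S J' B') :
    IsRegularizer lam0 S (J - J') (B - B') where
  mem v := (kdvbGraph lam0).sub_mem (h.mem v) (h'.mem v)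
  comm v t ht := by
    simp only [sub_apply]
    have hi : ∀ X : L2 →L[ℝ] L2, IntervalIntegrable (fun s => X (S (max s 0) v)) volume 0 t :=
      fun X => (X.continuous.comp (hS.continuous_apply v)).intervalIntegrable 0 t
    rw [h.comm v t ht, h'.comm v t ht, intervalIntegral.integral_sub (hi B) (hi B')]
    abel

/-- Insert the integral formula for J S(t − s) into the Duhamel integral and exchange the order of
integration over the triangle 0 < s < σ ≤ t, on which `k` is supported. -/
theorem IsRegularizer.duhamel_eq_integral (hS : IsC0Semigroup S) {J B : L2 →L[ℝ] L2}
    (h : IsRegularizer lam0 S J B) {g : ℝ → L2} (hg : LocallyIntegrable g volume) {t : ℝ}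
    (ht : 0 ≤ t) :
    J (duhamel S g t) = ∫ s in 0..t, (B (duhamel S g s) + J (g s)) := by
  obtain ⟨M, hM0, hM⟩ := hS.exists_bound t
  have hgt : IntegrableOn g (Ioc 0 t) :=
    (hg.integrableOn_isCompact isCompact_Icc).mono_set Ioc_subset_Icc_self
  set ν : Measure ℝ := volume.restrict (Ioc 0 t)
  let k : ℝ → ℝ → L2 := fun s σ => (Ioi s).indicator (fun σ => B (S (max (σ - s) 0) (g s))) σ
  have hk : Integrable (Function.uncurry k) (ν.prod ν) := by
    have e : Function.uncurry k = {p : ℝ × ℝ | p.1 < p.2}.indicator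
        (fun p => B (S (max (p.2 - p.1) 0) (g p.1))) := by
      funext p
      by_cases hp : p.1 < p.2 <;> simp [Function.uncurry, k, hp, indicator]
    rw [e]
    refine Integrable.indicator ?_ (measurableSet_lt measurable_fst measurable_snd)
    have hb : Integrable (fun p : ℝ × ℝ => ‖B‖ * (M * ‖g p.1‖)) (ν.prod ν) :=
      (((Integrable.comp_fst (f := fun s => ‖g s‖) hgt.norm ν).const_mul M).const_mul ‖B‖)
    refine Integrable.mono' hb ?_ ?_
    · refine B.continuous.comp_aestronglyMeasurable ?_
      exact hS.aestronglyMeasurable_comp (by fun_prop) hgt.aestronglyMeasurable.comp_fst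
    · simp only [ν]
      rw [Measure.prod_restrict]
      refine (ae_restrict_iff' (measurableSet_Ioc.prod measurableSet_Ioc)).2
        (Eventually.of_forall fun p hp => ?_)
      have h1 : p.1 ∈ Ioc 0 t := hp.1
      have h2 : p.2 ∈ Ioc 0 t := hp.2
      refine B.le_opNorm_of_le ((S _).le_of_opNorm_le (hM _ ⟨le_max_right _ _, ?_⟩) _)
      exact max_le (by linarith [h1.1, h2.2]) ht
  have hin1 : ∀ s ∈ Ioc 0 t, ∫ σ, k s σ ∂ν = ∫ r in 0..(t - s), B (S (max r 0) (g s)) := by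
    intro s hs
    have := intervalIntegral.integral_comp_sub_right (a := s) (b := t)
      (fun r => B (S (max r 0) (g s))) s
    rw [sub_self] at this
    rw [← this, intervalIntegral.integral_of_le hs.2]
    simp only [k, ν]
    rw [setIntegral_indicator measurableSet_Ioi]
    congr 2
    ext σ
    simp only [mem_inter_iff, mem_Ioc, mem_Ioi]
    exact ⟨fun hσ => ⟨hσ.2, hσ.1.2⟩, fun hσ => ⟨⟨hs.1.trans hσ.1, hσ.2⟩, hσ.1⟩⟩
  have hin2 : ∀ σ ∈ Ioc 0 t, ∫ s, k s σ ∂ν = B (duhamel S g σ) := by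
    intro σ hσ
    have e : ∀ s, k s σ = (Iio σ).indicator (fun s => B (S (max (σ - s) 0) (g s))) s := by
      intro s
      by_cases hs : s < σ <;> simp [k, hs, indicator]
    simp only [e, ν]
    rw [setIntegral_indicator measurableSet_Iio, duhamel_eq S g hσ.1.le,
      ← ContinuousLinearMap.intervalIntegral_comp_comm _
        (hS.intervalIntegrable_duhamel hg hσ.1.le), intervalIntegral.integral_of_le hσ.1.le,
      integral_Ioc_eq_integral_Ioo]
    have e2 : Ioc 0 t ∩ Iio σ = Ioo 0 σ := by
      ext s
      simp only [mem_inter_iff, mem_Ioc, mem_Iio, mem_Ioo]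
      exact ⟨fun h => ⟨h.1.1, h.2⟩, fun h => ⟨⟨h.1, h.2.le.trans hσ.2⟩, h.2⟩⟩
    rw [e2]
    refine setIntegral_congr_fun measurableSet_Ioo fun s hs => ?_
    rw [max_eq_left (sub_nonneg.2 hs.2.le)]
  have hJg : IntervalIntegrable (fun s => J (g s)) volume 0 t := by
    rw [intervalIntegrable_iff_integrableOn_Ioc_of_le ht]
    exact J.integrable_comp hgt
  have hBd : IntervalIntegrable (fun s => B (duhamel S g s)) volume 0 t :=
    (B.continuous.comp (hS.continuous_duhamel hg)).intervalIntegrable 0 t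
  have hswap : ∫ s in 0..t, (∫ r in 0..(t - s), B (S (max r 0) (g s)))
      = ∫ s in 0..t, B (duhamel S g s) := by
    rw [intervalIntegral.integral_of_le ht, intervalIntegral.integral_of_le ht,
      ← setIntegral_congr_fun measurableSet_Ioc hin1,
      ← setIntegral_congr_fun measurableSet_Ioc hin2]
    exact integral_integral_swap hk
  have hin3 : IntervalIntegrable (fun s => ∫ r in 0..(t - s), B (S (max r 0) (g s)))
      volume 0 t := by
    rw [intervalIntegrable_iff_integrableOn_Ioc_of_le ht]
    exact IntegrableOn.congr_fun hk.integral_prod_left hin1 measurableSet_Ioc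
  rw [intervalIntegral.integral_add hBd hJg, ← hswap, ← intervalIntegral.integral_add hin3 hJg,
    duhamel_eq S g ht, ← ContinuousLinearMap.intervalIntegral_comp_comm _
      (hS.intervalIntegrable_duhamel hg ht)]
  refine intervalIntegral.integral_congr fun s hs => ?_
  rw [uIcc_of_le ht] at hs
  rw [h.comm _ _ (sub_nonneg.2 hs.2), add_comm]

/-- After regularization a mild solution is a primitive of an integrable function, which is what the
chain rule for the squared norm requires. -/
theorem IsRegularizer.eq_integral (hS : IsC0Semigroup S) {J B : L2 →L[ℝ] L2}
    (h : IsRegularizer lam0 S J B) {u g : ℝ → L2} {T : ℝ} (hg : LocallyIntegrable g volume)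
    (hu : ∀ t ∈ Icc 0 T, u t = S t (u 0) + duhamel S g t) {t : ℝ} (ht : t ∈ Icc 0 T) :
    J (u t) = J (u 0) + ∫ s in 0..t, (B (u s) + J (g s)) := by
  have hJg : IntervalIntegrable (fun s => J (g s)) volume 0 t := by
    rw [intervalIntegrable_iff_integrableOn_Icc_of_le ht.1]
    exact J.integrable_comp (hg.integrableOn_isCompact isCompact_Icc)
  have hBd : IntervalIntegrable (fun s => B (duhamel S g s)) volume 0 t :=
    (B.continuous.comp (hS.continuous_duhamel hg)).intervalIntegrable 0 t
  have hBS : IntervalIntegrable (fun s => B (S (max s 0) (u 0))) volume 0 t :=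
    (B.continuous.comp (hS.continuous_apply (u 0))).intervalIntegrable 0 t
  have e : ∀ s ∈ uIcc 0 t, B (u s) + J (g s)
      = B (S (max s 0) (u 0)) + (B (duhamel S g s) + J (g s)) := by
    intro s hs
    rw [uIcc_of_le ht.1] at hs
    rw [hu s ⟨hs.1, hs.2.trans ht.2⟩, max_eq_left hs.1, map_add, add_assoc]
  rw [intervalIntegral.integral_congr e, intervalIntegral.integral_add hBS (hBd.add hJg),
    ← h.duhamel_eq_integral hS hg ht.1, ← add_assoc, ← h.comm _ _ ht.1, ← map_add, ← hu t ht]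

/-- The energy identity of the generator reads ‖(Jv)_x‖² = −⟨Bv, Jv⟩ − ⟨λ₀Jv, Jv⟩, so v ↦ (Jv)_x is
bounded. In particular ∂J u(s) is continuous in s. -/
theorem IsRegularizer.exists_weakDeriv {J B : L2 →L[ℝ] L2} (h : IsRegularizer lam0 S J B) :
    ∃ K : L2 →L[ℝ] L2, ∀ v, HasWeakDeriv (J v) (K v) := by
  have hex : ∀ v, ∃ w, HasWeakDeriv (J v) w := fun v => by
    obtain ⟨v1, _, _, h1, _⟩ := mem_kdvbGraph.1 (h.mem v)
    exact ⟨v1, h1⟩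
  choose K hK using hex
  let L : L2 →ₗ[ℝ] L2 :=
    { toFun := K
      map_add' := fun v w => by
        refine (hK (v + w)).unique ?_
        rw [map_add]
        exact (hK v).add (hK w)
      map_smul' := fun c v => by
        refine (hK (c • v)).unique ?_
        rw [map_smul]
        exact (hK v).const_smul c }
  -- The identity bounds the square by c‖v‖²; the added 1 serves c ≤ (c + 1)² and avoids a square
  -- root.
  have hb : ∀ v, ‖L v‖ ≤ (‖B‖ * ‖J‖ + ‖lam0‖ * ‖J‖ * ‖J‖ + 1) * ‖v‖ := by
    intro v
    have h1 := inner_kdvbGraph (h.mem v)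
    simp only [(hK v).weakDeriv_eq] at h1
    have h2 := abs_le.1 ((abs_real_inner_le_norm (B v) (J v)).trans
      (mul_le_mul (B.le_opNorm v) (J.le_opNorm v) (norm_nonneg _) (by positivity)))
    have h3 := abs_le.1 ((abs_inner_mulOp_le lam0 (J v) (J v)).trans
      (mul_le_mul (mul_le_mul_of_nonneg_left (J.le_opNorm v) (norm_nonneg _)) (J.le_opNorm v)
        (norm_nonneg _) (by positivity)))
    set c := ‖B‖ * ‖J‖ + ‖lam0‖ * ‖J‖ * ‖J‖
    have hc : 0 ≤ c := by positivity
    refine abs_le_of_sq_le_sq' ?_ (by positivity) |>.2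
    change ‖K v‖ ^ 2 ≤ _
    calc ‖K v‖ ^ 2 ≤ c * ‖v‖ ^ 2 := by simp only [c]; nlinarith [h2.1, h3.1]
      _ ≤ ((c + 1) * ‖v‖) ^ 2 := by
        rw [mul_pow]
        gcongr
        nlinarith
  exact ⟨L.mkContinuous _ hb, hK⟩

theorem intervalIntegrable_inner {E : Type*} [NormedAddCommGroup E]
    [InnerProductSpace ℝ E] {g v : ℝ → E}
    (hg : LocallyIntegrable g volume) (hv : Continuous v) (a b : ℝ) :
    IntervalIntegrable (fun s => inner ℝ (g s) (v s)) volume a b := by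
  rw [intervalIntegrable_iff]
  have hi : IntegrableOn g (uIoc a b) :=
    (hg.integrableOn_isCompact isCompact_uIcc).mono_set uIoc_subset_uIcc
  obtain ⟨C, hC⟩ := isCompact_uIcc.exists_bound_of_continuousOn (s := uIcc a b) hv.continuousOn
  refine Integrable.mono' (g := fun s => ‖g s‖ * C) (hi.norm.mul_const C)
    (hi.aestronglyMeasurable.inner hv.aestronglyMeasurable.restrict) ?_
  refine (ae_restrict_iff' measurableSet_uIoc).2 (Eventually.of_forall fun s hs => ?_)
  exact (norm_inner_le_norm _ _).trans
    (mul_le_mul_of_nonneg_left (hC s (uIoc_subset_uIcc hs)) (norm_nonneg _))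

theorem locallyIntegrable_clm_comp {g : ℝ → L2} (J : L2 →L[ℝ] L2)
    (hg : LocallyIntegrable g volume) : LocallyIntegrable (fun s => J (g s)) volume := by
  rw [locallyIntegrable_iff] at hg ⊢
  exact fun k hk => J.integrable_comp (hg k hk)

/-- The energy identity for regularized mild solutions. -/
theorem IsRegularizer.energy (hS : IsC0Semigroup S) {J B K : L2 →L[ℝ] L2}
    (h : IsRegularizer lam0 S J B) (hK : ∀ v, HasWeakDeriv (J v) (K v)) {u g : ℝ → L2} {T : ℝ}
    (hg : LocallyIntegrable g volume) (huc : Continuous u)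
    (hu : ∀ t ∈ Icc 0 T, u t = S t (u 0) + duhamel S g t) {t : ℝ} (ht : t ∈ Icc 0 T) :
    ‖J (u t)‖ ^ 2 + 2 * (∫ s in 0..t, ‖K (u s)‖ ^ 2)
        + 2 * (∫ s in 0..t, inner ℝ (mulOp lam0 (J (u s))) (J (u s)))
      = ‖J (u 0)‖ ^ 2 + 2 * ∫ s in 0..t, inner ℝ (J (g s)) (J (u s)) := by
  have hJg := locallyIntegrable_clm_comp J hg
  have hBu : LocallyIntegrable (fun s => B (u s)) volume :=
    (by fun_prop : Continuous fun s => B (u s)).locallyIntegrable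
  have hJu : Continuous (fun s => J (u s)) := by fun_prop
  have h1 := norm_sq_eq_of_eq_integral (U := fun s => J (u s)) (hBu.add hJg)
    (fun t ht => h.eq_integral hS hg hu ht) ht
  have e : ∀ s, inner ℝ (((fun s => B (u s)) + fun s => J (g s)) s) (J (u s))
      = (- ‖K (u s)‖ ^ 2 - inner ℝ (mulOp lam0 (J (u s))) (J (u s)))
        + inner ℝ (J (g s)) (J (u s)) := by
    intro s
    have := inner_kdvbGraph (h.mem (u s))
    simp only [(hK (u s)).weakDeriv_eq] at this
    rw [Pi.add_apply, inner_add_left, this]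
  have i1 : IntervalIntegrable (fun s => - ‖K (u s)‖ ^ 2) volume 0 t :=
    (by fun_prop : Continuous fun s => - ‖K (u s)‖ ^ 2).intervalIntegrable 0 t
  have i2 : IntervalIntegrable (fun s => inner ℝ (mulOp lam0 (J (u s))) (J (u s))) volume 0 t :=
    (by fun_prop : Continuous fun s =>
      (inner ℝ (mulOp lam0 (J (u s))) (J (u s)) : ℝ)).intervalIntegrable 0 t
  have i3 := intervalIntegrable_inner hJg hJu 0 t
  simp only [e] at h1
  rw [intervalIntegral.integral_add (i1.sub i2) i3, intervalIntegral.integral_sub i1 i2,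
    intervalIntegral.integral_neg] at h1
  linarith

end Energy

/-! ### Removing the regularization: smoothing and the energy identity -/

section EnergyLimit

variable {S : ℝ → L2 →L[ℝ] L2} {lam0 : Linf}

theorem norm_sq_eq_integral {α H : Type*} [MeasurableSpace α] {μ : Measure α}
    [NormedAddCommGroup H] [InnerProductSpace ℝ H] (F : Lp H 2 μ) :
    ‖F‖ ^ 2 = ∫ s, ‖F s‖ ^ 2 ∂μ := by
  rw [← real_inner_self_eq_norm_sq, L2.inner_def]
  simp only [real_inner_self_eq_norm_sq]

theorem norm_toLp_sq {α H : Type*} [MeasurableSpace α] {μ : Measure α}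
    [NormedAddCommGroup H] [InnerProductSpace ℝ H] {f : α → H} (hf : MemLp f 2 μ) :
    ‖hf.toLp f‖ ^ 2 = ∫ s, ‖f s‖ ^ 2 ∂μ := by
  rw [norm_sq_eq_integral]
  refine integral_congr_ae ?_
  filter_upwards [hf.coeFn_toLp] with s hs
  rw [hs]

theorem memLp_two_of_continuous {E : Type*} [NormedAddCommGroup E]
    {f : ℝ → E} (hf : Continuous f) (a b : ℝ) : MemLp f 2 (volume.restrict (Ioc a b)) := by
  obtain ⟨C, hC⟩ := isCompact_Icc.exists_bound_of_continuousOn (s := Icc a b) hf.continuousOn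
  refine MemLp.of_bound hf.aestronglyMeasurable.restrict C ?_
  exact (ae_restrict_iff' measurableSet_Ioc).2
    (Eventually.of_forall fun s hs => hC s (Ioc_subset_Icc_self hs))

/-- The energy inequality for differences of regularized solutions. -/
theorem IsRegularizer.integral_norm_sq_le (hS : IsC0Semigroup S) {J B K : L2 →L[ℝ] L2}
    (h : IsRegularizer lam0 S J B) (hK : ∀ v, HasWeakDeriv (J v) (K v)) {u g : ℝ → L2} {T P : ℝ}
    (hT : 0 ≤ T) (hg : LocallyIntegrable g volume) (huc : Continuous u)
    (hu : ∀ t ∈ Icc 0 T, u t = S t (u 0) + duhamel S g t) (hP : ∀ s ∈ Icc 0 T, ‖J (u s)‖ ≤ P) :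
    ∫ s in 0..T, ‖K (u s)‖ ^ 2 ≤ P * ‖J (u 0)‖ + ‖lam0‖ * P * (∫ s in 0..T, ‖J (u s)‖)
      + P * ∫ s in 0..T, ‖J (g s)‖ := by
  have hP0 : 0 ≤ P := (norm_nonneg _).trans (hP 0 ⟨le_rfl, hT⟩)
  have hen := h.energy hS hK hg huc hu (right_mem_Icc.2 hT)
  have hJg : IntervalIntegrable (fun s => J (g s)) volume 0 T := by
    rw [intervalIntegrable_iff_integrableOn_Icc_of_le hT]
    exact J.integrable_comp (hg.integrableOn_isCompact isCompact_Icc)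
  have e1 : |∫ s in 0..T, inner ℝ (mulOp lam0 (J (u s))) (J (u s))|
      ≤ ∫ s in 0..T, ‖lam0‖ * P * ‖J (u s)‖ := by
    rw [← Real.norm_eq_abs]
    refine intervalIntegral.norm_integral_le_of_norm_le hT (Eventually.of_forall fun s hs => ?_)
      ((by fun_prop : Continuous fun s => ‖lam0‖ * P * ‖J (u s)‖).intervalIntegrable 0 T)
    refine (abs_inner_mulOp_le _ _ _).trans ?_
    gcongr
    exact hP s (Ioc_subset_Icc_self hs)
  have e2 : |∫ s in 0..T, inner ℝ (J (g s)) (J (u s))| ≤ ∫ s in 0..T, P * ‖J (g s)‖ := by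
    rw [← Real.norm_eq_abs]
    refine intervalIntegral.norm_integral_le_of_norm_le hT (Eventually.of_forall fun s hs => ?_)
      (hJg.norm.const_mul P)
    refine (norm_inner_le_norm _ _).trans ?_
    rw [mul_comm]
    gcongr
    exact hP s (Ioc_subset_Icc_self hs)
  rw [intervalIntegral.integral_const_mul] at e1 e2
  have e3 : ‖J (u 0)‖ ^ 2 ≤ P * ‖J (u 0)‖ := by
    rw [sq]
    exact mul_le_mul_of_nonneg_right (hP 0 ⟨le_rfl, hT⟩) (norm_nonneg _)
  have e4 : 0 ≤ P * ‖J (u 0)‖ := by positivity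
  have := (abs_le.1 e1).1
  have := (abs_le.1 e2).2
  nlinarith [sq_nonneg ‖J (u T)‖]

theorem intervalIntegrable_of_locallyIntegrable {E : Type*} [NormedAddCommGroup E] {g : ℝ → E}
    (hg : LocallyIntegrable g volume) (a b : ℝ) : IntervalIntegrable g volume a b := by
  rw [intervalIntegrable_iff]
  exact (hg.integrableOn_isCompact isCompact_uIcc).mono_set uIoc_subset_uIcc

theorem intervalIntegrable_clm_comp (J : L2 →L[ℝ] L2) {g : ℝ → L2}
    (hg : LocallyIntegrable g volume) (a b : ℝ) :
    IntervalIntegrable (fun s => J (g s)) volume a b :=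
  intervalIntegrable_of_locallyIntegrable (locallyIntegrable_clm_comp J hg) a b

/-- The energy identity at the final time, together with the smoothing `u ∈ L²(0, T; H¹)`. -/
theorem energy_identity_endpoint (hS : IsKdVBSemigroup lam0 S) {u g : ℝ → L2} {T : ℝ}
    (hT : 0 ≤ T) (hg : LocallyIntegrable g volume) (huc : Continuous u)
    (hu : ∀ t ∈ Icc 0 T, u t = S t (u 0) + duhamel S g t) :
    MemL2H1 T u ∧ ‖u T‖ ^ 2 + 2 * (∫ s in 0..T, ‖weakDeriv (u s)‖ ^ 2)
        + 2 * (∫ s in 0..T, inner ℝ (mulOp lam0 (u s)) (u s))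
      = ‖u 0‖ ^ 2 + 2 * ∫ s in 0..T, inner ℝ (g s) (u s) := by
  have hC0 := hS.toIsC0Semigroup
  obtain ⟨J, B, C, hC, hJb, hJt, hgen, hcomm⟩ := hC0.exists_regularization
  have hreg : ∀ n, IsRegularizer lam0 S (J n) (B n) := fun n =>
    ⟨fun v => (hS.generator _ _).1 (hgen n v), hcomm n⟩
  choose K hK using fun n => (hreg n).exists_weakDeriv
  obtain ⟨R, hR⟩ := isCompact_Icc.exists_bound_of_continuousOn (s := Icc 0 T) huc.continuousOn
  have hR0 : 0 ≤ R := (norm_nonneg _).trans (hR 0 ⟨le_rfl, hT⟩)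
  -- A bound for ‖(J n − J m) u(s)‖ on [0, T], uniform in n and m.
  set P := 2 * (C * R)
  have hJd : ∀ n v, ‖J n v - v‖ ≤ (C + 1) * ‖v‖ := fun n v =>
    (norm_sub_le _ _).trans (by linarith [hJb n v])
  have htend : ∀ v, Tendsto (fun n => ‖J n v - v‖) atTop (𝓝 0) := fun v =>
    tendsto_iff_norm_sub_tendsto_zero.1 (hJt v)
  have hlint : ∀ {h : ℝ → L2}, LocallyIntegrable h volume →
      Tendsto (fun n => ∫ s in 0..T, ‖J n (h s) - h s‖) atTop (𝓝 0) := by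
    intro h hh
    have hhi : IntervalIntegrable h volume 0 T := intervalIntegrable_of_locallyIntegrable hh 0 T
    have := intervalIntegral.tendsto_integral_filter_of_dominated_convergence (μ := volume)
      (a := 0) (b := T) (l := atTop) (F := fun n s => ‖J n (h s) - h s‖) (f := fun _ => 0)
      (fun s => (C + 1) * ‖h s‖)
      (Eventually.of_forall fun n =>
        (((intervalIntegrable_clm_comp (J n) hh 0 T).sub hhi).norm).def'.aestronglyMeasurable)
      (Eventually.of_forall fun n => Eventually.of_forall fun s _ => by
        rw [norm_norm]; exact hJd n _)
      (hhi.norm.const_mul _) (Eventually.of_forall fun s _ => htend (h s))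
    simpa using this
  have huL : LocallyIntegrable u volume := huc.locallyIntegrable
  let ε : ℕ → ℝ := fun n => P * ‖J n (u 0) - u 0‖
    + ‖lam0‖ * P * (∫ s in 0..T, ‖J n (u s) - u s‖) + P * ∫ s in 0..T, ‖J n (g s) - g s‖
  have hε : Tendsto ε atTop (𝓝 0) := by
    simpa using (((htend (u 0)).const_mul P).add ((hlint huL).const_mul (‖lam0‖ * P))).add
      ((hlint hg).const_mul P)
  have hP0 : 0 ≤ P := by positivity
  -- The difference J n − J m is itself a regularizer, so the energy inequality applies to it;
  -- comparing both operators with the identity produces ε n + ε m.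
  have hD : ∀ n m, ∫ s in 0..T, ‖K n (u s) - K m (u s)‖ ^ 2 ≤ ε n + ε m := by
    intro n m
    have h1 := ((hreg n).sub hC0 (hreg m)).integral_norm_sq_le hC0 (K := K n - K m)
      (fun v => by
        have := (hK n v).add ((hK m v).const_smul (-1))
        simpa [sub_eq_add_neg] using this) (P := P) hT hg huc hu (fun s hs => by
        rw [sub_apply]
        refine (norm_sub_le _ _).trans ?_
        have h1 := hJb n (u s)
        have h2 := hJb m (u s)
        have h3 : C * ‖u s‖ ≤ C * R := mul_le_mul_of_nonneg_left (hR s hs) hC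
        simp only [P]; linarith)
    simp only [sub_apply] at h1
    have htri : ∀ v, ‖J n v - J m v‖ ≤ ‖J n v - v‖ + ‖J m v - v‖ := fun v => by
      rw [norm_sub_rev (J m v)]
      exact norm_sub_le_norm_sub_add_norm_sub _ _ _
    have hint : ∀ {h : ℝ → L2}, LocallyIntegrable h volume →
        ∫ s in 0..T, ‖J n (h s) - J m (h s)‖
          ≤ (∫ s in 0..T, ‖J n (h s) - h s‖) + ∫ s in 0..T, ‖J m (h s) - h s‖ := by
      intro h hh
      have hhi : IntervalIntegrable h volume 0 T := intervalIntegrable_of_locallyIntegrable hh 0 T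
      have i1 := intervalIntegrable_clm_comp (J n) hh 0 T
      have i2 := intervalIntegrable_clm_comp (J m) hh 0 T
      rw [← intervalIntegral.integral_add (i1.sub hhi).norm (i2.sub hhi).norm]
      exact intervalIntegral.integral_mono_on hT (i1.sub i2).norm
        ((i1.sub hhi).norm.add (i2.sub hhi).norm) fun s _ => htri (h s)
    refine h1.trans ?_
    have h2 := mul_le_mul_of_nonneg_left (htri (u 0)) hP0
    have h3 := mul_le_mul_of_nonneg_left (hint huL) (mul_nonneg (norm_nonneg lam0) hP0)
    have h4 := mul_le_mul_of_nonneg_left (hint hg) hP0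
    simp only [ε]
    linarith
  set μ : Measure ℝ := volume.restrict (Ioc 0 T)
  have hwc : ∀ n, Continuous fun s => K n (u s) := fun n => by fun_prop
  have hwm : ∀ n, MemLp (fun s => K n (u s)) 2 μ := fun n => memLp_two_of_continuous (hwc n) 0 T
  let f : ℕ → Lp L2 2 μ := fun n => (hwm n).toLp _
  have hfc : CauchySeq f := by
    rw [Metric.cauchySeq_iff]
    intro δ hδ
    obtain ⟨N, hN⟩ := eventually_atTop.1
      (hε.eventually (gt_mem_nhds (by positivity : 0 < δ ^ 2 / 2)))
    refine ⟨N, fun m hm n hn => ?_⟩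
    rw [dist_eq_norm]
    refine lt_of_pow_lt_pow_left₀ 2 hδ.le ?_
    have e : ‖f m - f n‖ ^ 2 = ∫ s in 0..T, ‖K m (u s) - K n (u s)‖ ^ 2 := by
      simp only [f]
      rw [← MemLp.toLp_sub, norm_toLp_sq, intervalIntegral.integral_of_le hT]
      rfl
    rw [e]
    linarith [hD m n, hN m hm, hN n hn]
  obtain ⟨F, hF⟩ := cauchySeq_tendsto_of_complete hfc
  -- Along a subsequence the convergence holds at almost every time, and closedness of the weak
  -- derivative identifies the limit there with u_x.
  obtain ⟨ns, hns, hae⟩ := (tendstoInMeasure_of_tendsto_Lp hF).exists_seq_tendsto_ae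
  have hweak : ∀ᵐ s ∂μ, HasWeakDeriv (u s) (F s) := by
    have hall : ∀ᵐ s ∂μ, ∀ n, f n s = K n (u s) := ae_all_iff.2 fun n => (hwm n).coeFn_toLp
    filter_upwards [hall, hae] with s hs1 hs2
    simp only [hs1] at hs2
    exact hasWeakDeriv_of_tendsto (fun i => hK (ns i) (u s))
      ((hJt (u s)).comp hns.tendsto_atTop) hs2
  have hwd : F =ᵐ[μ] fun s => weakDeriv (u s) := by
    filter_upwards [hweak] with s hs
    exact hs.weakDeriv_eq.symm
  refine ⟨?_, ?_⟩
  · have hμ : volume.restrict (Ioo 0 T) = μ := Measure.restrict_congr_set Ioo_ae_eq_Ioc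
    refine ⟨?_, ?_, ?_⟩
    · rw [hμ]
      filter_upwards [hweak] with s hs
      exact ⟨_, hs, trivial⟩
    · rw [hμ]
      exact memLp_two_of_continuous huc 0 T
    · rw [hμ]
      exact (memLp_congr_ae hwd).1 (Lp.memLp F)
  · have l1 : Tendsto (fun n => ‖J n (u T)‖ ^ 2) atTop (𝓝 (‖u T‖ ^ 2)) := (hJt _).norm.pow 2
    have l0 : Tendsto (fun n => ‖J n (u 0)‖ ^ 2) atTop (𝓝 (‖u 0‖ ^ 2)) := (hJt _).norm.pow 2
    have l2 : Tendsto (fun n => ∫ s in 0..T, ‖K n (u s)‖ ^ 2) atTop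
        (𝓝 (∫ s in 0..T, ‖weakDeriv (u s)‖ ^ 2)) := by
      have h1 : ‖F‖ ^ 2 = ∫ s in 0..T, ‖weakDeriv (u s)‖ ^ 2 := by
        rw [norm_sq_eq_integral, intervalIntegral.integral_of_le hT]
        refine integral_congr_ae ?_
        filter_upwards [hwd] with s hs
        rw [hs]
      rw [← h1]
      refine (hF.norm.pow 2).congr fun n => ?_
      rw [norm_toLp_sq, intervalIntegral.integral_of_le hT]
    have l3 : Tendsto (fun n => ∫ s in 0..T, inner ℝ (mulOp lam0 (J n (u s))) (J n (u s))) atTop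
        (𝓝 (∫ s in 0..T, inner ℝ (mulOp lam0 (u s)) (u s))) := by
      refine intervalIntegral.tendsto_integral_filter_of_dominated_convergence
        (fun s => ‖lam0‖ * (C * ‖u s‖) * (C * ‖u s‖)) (Eventually.of_forall fun n => ?_)
        (Eventually.of_forall fun n => Eventually.of_forall fun s _ => ?_)
        ((by fun_prop : Continuous fun s => ‖lam0‖ * (C * ‖u s‖) * (C * ‖u s‖)).intervalIntegrable
          0 T) (Eventually.of_forall fun s _ => ?_)
      · exact (by fun_prop : Continuous fun s =>
          (inner ℝ (mulOp lam0 (J n (u s))) (J n (u s)) : ℝ)).aestronglyMeasurable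
      · refine (abs_inner_mulOp_le _ _ _).trans ?_
        gcongr <;> exact hJb n _
      · exact (((mulOp lam0).continuous.tendsto _).comp (hJt (u s))).inner (hJt (u s))
    have l4 : Tendsto (fun n => ∫ s in 0..T, inner ℝ (J n (g s)) (J n (u s))) atTop
        (𝓝 (∫ s in 0..T, inner ℝ (g s) (u s))) := by
      refine intervalIntegral.tendsto_integral_filter_of_dominated_convergence
        (fun s => (C * ‖g s‖) * (C * R)) (Eventually.of_forall fun n => ?_)
        (Eventually.of_forall fun n => Eventually.of_forall fun s hs => ?_) ?_
        (Eventually.of_forall fun s _ => (hJt (g s)).inner (hJt (u s)))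
      · exact (intervalIntegrable_inner (locallyIntegrable_clm_comp (J n) hg)
          (by fun_prop : Continuous fun s => J n (u s)) 0 T).def'.aestronglyMeasurable
      · rw [uIoc_of_le hT] at hs
        refine (norm_inner_le_norm _ _).trans ?_
        refine mul_le_mul (hJb n _) ((hJb n _).trans ?_) (norm_nonneg _) (by positivity)
        exact mul_le_mul_of_nonneg_left (hR s (Ioc_subset_Icc_self hs)) hC
      · have hgi : IntervalIntegrable g volume 0 T := intervalIntegrable_of_locallyIntegrable hg 0 T
        exact (hgi.norm.const_mul C).mul_const (C * R)
    have hl := (l1.add (l2.const_mul 2)).add (l3.const_mul 2)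
    have hr := l0.add (l4.const_mul 2)
    exact tendsto_nhds_unique hl (hr.congr fun n =>
      ((hreg n).energy hC0 (hK n) hg huc hu (right_mem_Icc.2 hT)).symm)

end EnergyLimit

/-! ### Quadratic Gronwall inequalities -/

section Gronwall

/-- A quadratic Gronwall inequality with a continuous inhomogeneity. -/
theorem gronwall_sq_of_continuous {y h : ℝ → ℝ} {T K a : ℝ} (hy : Continuous y)
    (hh : Continuous h) (hh0 : ∀ s, 0 ≤ h s) (ha : 0 ≤ a)
    (hle : ∀ t ∈ Icc 0 T, y t ^ 2 ≤ K + 2 * a * (∫ s in 0..t, y s ^ 2) + 2 * ∫ s in 0..t, h s * y s)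
    (hpos : ∀ t ∈ Icc 0 T, 0 < K + 2 * a * (∫ s in 0..t, y s ^ 2) + 2 * ∫ s in 0..t, h s * y s)
    {t : ℝ} (ht : t ∈ Icc 0 T) :
    K + 2 * a * (∫ s in 0..t, y s ^ 2) + 2 * (∫ s in 0..t, h s * y s)
      ≤ ((√K + ∫ s in 0..t, h s) * Real.exp (a * t)) ^ 2 := by
  let Φ : ℝ → ℝ := fun t => K + 2 * a * (∫ s in 0..t, y s ^ 2) + 2 * ∫ s in 0..t, h s * y s
  have hΦ : ∀ t, HasDerivAt Φ (2 * a * y t ^ 2 + 2 * (h t * y t)) t := fun t =>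
    ((((hy.pow 2).integral_hasStrictDerivAt 0 t).hasDerivAt.const_mul (2 * a)).const_add K).add
      (((hh.mul hy).integral_hasStrictDerivAt 0 t).hasDerivAt.const_mul 2)
  -- From Φ' ≤ 2aΦ + 2h√Φ one gets (√Φ)' ≤ a√Φ + h. After multiplication by e^{−at} ≤ 1 this makes ψ
  -- nonincreasing; positivity of Φ makes the root differentiable.
  let ψ : ℝ → ℝ := fun t => √(Φ t) * Real.exp (-a * t) - ∫ s in 0..t, h s
  have hψ : ∀ t ∈ Icc 0 T, HasDerivAt ψ ((2 * a * y t ^ 2 + 2 * (h t * y t)) / (2 * √(Φ t))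
      * Real.exp (-a * t) + √(Φ t) * (Real.exp (-a * t) * (-a * 1)) - h t) t := fun t ht =>
    (((hΦ t).sqrt (hpos t ht).ne').mul ((hasDerivAt_id t).const_mul (-a)).exp).sub
      (hh.integral_hasStrictDerivAt 0 t).hasDerivAt
  have hanti : AntitoneOn ψ (Icc 0 T) := by
    refine antitoneOn_of_deriv_nonpos (convex_Icc 0 T)
      (fun s hs => (hψ s hs).continuousAt.continuousWithinAt)
      (fun s hs => (hψ s (interior_subset hs)).differentiableAt.differentiableWithinAt)
      fun s hs => ?_
    have hs' := interior_subset hs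
    rw [(hψ s hs').deriv]
    have hp : 0 < Φ s := hpos s hs'
    have hr : 0 < √(Φ s) := Real.sqrt_pos.2 hp
    have hyr : y s ≤ √(Φ s) := Real.le_sqrt_of_sq_le (hle s hs')
    have hsq : y s ^ 2 ≤ √(Φ s) ^ 2 := by rw [Real.sq_sqrt hp.le]; exact hle s hs'
    have h1 : (2 * a * y s ^ 2 + 2 * (h s * y s)) / (2 * √(Φ s)) ≤ a * √(Φ s) + h s := by
      rw [div_le_iff₀ (by positivity)]
      nlinarith [mul_le_mul_of_nonneg_left hyr (hh0 s), mul_le_mul_of_nonneg_left hsq ha]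
    have h2 : Real.exp (-a * s) ≤ 1 := by
      rw [Real.exp_le_one_iff]
      nlinarith [hs'.1]
    have h3 := mul_le_mul_of_nonneg_right h1 (Real.exp_pos (-a * s)).le
    nlinarith [mul_le_mul_of_nonneg_left h2 (hh0 s)]
  have h0 := hanti (left_mem_Icc.2 (ht.1.trans ht.2)) ht ht.1
  simp only [ψ, Φ, intervalIntegral.integral_same, mul_zero, add_zero, Real.exp_zero, mul_one,
    sub_zero] at h0
  have h1 : √(Φ t) ≤ (√K + ∫ s in 0..t, h s) * Real.exp (a * t) := by
    have h2 : √(Φ t) * Real.exp (-a * t) ≤ √K + ∫ s in 0..t, h s := by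
      simp only [Φ]; linarith
    have h3 := mul_le_mul_of_nonneg_right h2 (Real.exp_pos (a * t)).le
    rwa [mul_assoc, ← Real.exp_add, neg_mul, neg_add_cancel, Real.exp_zero, mul_one] at h3
  have h4 := pow_le_pow_left₀ (Real.sqrt_nonneg _) h1 2
  rwa [Real.sq_sqrt (hpos t ht).le] at h4

/-- A quadratic Gronwall inequality with an integrable inhomogeneity. -/
theorem gronwall_sq {y g : ℝ → ℝ} {T K a : ℝ} (hy : Continuous y)
    (hg : IntegrableOn g (Ioc 0 T)) (hg0 : ∀ s, 0 ≤ g s) (hK : 0 ≤ K) (ha : 0 ≤ a)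
    (hle : ∀ t ∈ Icc 0 T, y t ^ 2 ≤ K + 2 * a * (∫ s in 0..t, y s ^ 2) + 2 * ∫ s in 0..t, g s * y s)
    {t : ℝ} (ht : t ∈ Icc 0 T) :
    K + 2 * a * (∫ s in 0..t, y s ^ 2) + 2 * (∫ s in 0..t, g s * y s)
      ≤ ((√K + ∫ s in 0..t, g s) * Real.exp (a * t)) ^ 2 := by
  obtain ⟨M, hM⟩ := isCompact_Icc.exists_bound_of_continuousOn (s := Icc 0 T) hy.continuousOn
  have hM0 : 0 ≤ M := (norm_nonneg _).trans (hM t ht)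
  have hgi : Integrable ((Ioc 0 T).indicator g) := hg.integrable_indicator measurableSet_Ioc
  -- Replace g by |q| with q continuous and ε-close in L¹. In the enlarged constant, 2εM absorbs the
  -- change in 2∫ g y, and the extra ε keeps the right side positive.
  have key : ∀ ε > 0, K + 2 * a * (∫ s in 0..t, y s ^ 2) + 2 * (∫ s in 0..t, g s * y s)
      ≤ ((√(K + ε + 2 * (ε * M)) + ((∫ s in 0..t, g s) + ε)) * Real.exp (a * t)) ^ 2 := by
    intro ε hε
    obtain ⟨q, -, hq, hqc, hqi⟩ := hgi.exists_hasCompactSupport_integral_sub_le hε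
    have hdiff : ∀ s ∈ Ioc 0 T, |g s - (|q s|)| ≤ ‖(Ioc 0 T).indicator g s - q s‖ := fun s hs => by
      rw [indicator_of_mem hs, Real.norm_eq_abs]
      conv_lhs => rw [← abs_of_nonneg (hg0 s)]
      exact abs_abs_sub_abs_le_abs_sub _ _
    have hgt : ∀ r ∈ Icc 0 T, IntegrableOn g (Ioc 0 r) := fun r hr =>
      hg.mono_set (Ioc_subset_Ioc_right hr.2)
    have hdint : ∀ r ∈ Icc 0 T, ∫ s in 0..r, |g s - (|q s|)| ≤ ε := fun r hr => by
      rw [intervalIntegral.integral_of_le hr.1]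
      have i1 : IntegrableOn (fun s => ‖(Ioc 0 T).indicator g s - q s‖) (Ioc 0 r) :=
        (hgi.sub hqi).norm.integrableOn
      have i2 : IntegrableOn (fun s => |g s - (|q s|)|) (Ioc 0 r) :=
        ((hgt r hr).sub hqi.abs.integrableOn).abs
      refine (setIntegral_mono_on i2 i1 measurableSet_Ioc fun s hs =>
        hdiff s ⟨hs.1, hs.2.trans hr.2⟩).trans ?_
      exact (setIntegral_le_integral (hgi.sub hqi).norm
        (Eventually.of_forall fun _ => norm_nonneg _)).trans hq
    have hII : ∀ r ∈ Icc 0 T, IntervalIntegrable g volume 0 r := fun r hr =>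
      (intervalIntegrable_iff_integrableOn_Ioc_of_le hr.1).2 (hgt r hr)
    have hIq : ∀ r, IntervalIntegrable (fun s => |q s|) volume 0 r := fun r =>
      hqc.abs.intervalIntegrable 0 r
    have hgy : ∀ r ∈ Icc 0 T, IntervalIntegrable (fun s => g s * y s) volume 0 r := fun r hr =>
      (hII r hr).mul_continuousOn hy.continuousOn
    have hqy : ∀ r, IntervalIntegrable (fun s => |q s| * y s) volume 0 r := fun r =>
      (hqc.abs.mul hy).intervalIntegrable 0 r
    have hcmp : ∀ r ∈ Icc 0 T,
        |(∫ s in 0..r, g s * y s) - ∫ s in 0..r, (|q s|) * y s| ≤ ε * M := by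
      intro r hr
      rw [← intervalIntegral.integral_sub (hgy r hr) (hqy r), ← Real.norm_eq_abs]
      refine (intervalIntegral.norm_integral_le_of_norm_le hr.1
        (g := fun s => |g s - (|q s|)| * M) (Eventually.of_forall fun s hs => ?_)
        (((hII r hr).sub (hIq r)).abs.mul_const M)).trans ?_
      · rw [← sub_mul, norm_mul, Real.norm_eq_abs]
        gcongr
        exact hM s ⟨hs.1.le, hs.2.trans hr.2⟩
      · rw [intervalIntegral.integral_mul_const]
        exact mul_le_mul_of_nonneg_right (hdint r hr) hM0
    have hcmp' : (∫ s in 0..t, |q s|) ≤ (∫ s in 0..t, g s) + ε := by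
      have h1 : |(∫ s in 0..t, g s) - ∫ s in 0..t, (|q s|)| ≤ ε := by
        rw [← intervalIntegral.integral_sub (hII t ht) (hIq t)]
        exact (intervalIntegral.abs_integral_le_integral_abs ht.1).trans (hdint t ht)
      linarith [(abs_le.1 h1).1]
    have hle' : ∀ r ∈ Icc 0 T, y r ^ 2 + ε ≤ (K + ε + 2 * (ε * M))
        + 2 * a * (∫ s in 0..r, y s ^ 2) + 2 * ∫ s in 0..r, |q s| * y s := fun r hr => by
      have := hle r hr
      have := (abs_le.1 (hcmp r hr)).2
      linarith
    have hpow : ∀ r, 0 ≤ y r ^ 2 := fun r => sq_nonneg _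
    have hmain := gronwall_sq_of_continuous (T := T) (K := K + ε + 2 * (ε * M)) (a := a) hy hqc.abs
      (fun s => abs_nonneg _) ha (fun r hr => by linarith [hle' r hr])
      (fun r hr => by linarith [hle' r hr, hpow r]) ht
    have h5 := (abs_le.1 (hcmp t ht)).2
    refine (by linarith : _ ≤ _).trans (hmain.trans ?_)
    have h6 : 0 ≤ ∫ s in 0..t, |q s| :=
      intervalIntegral.integral_nonneg ht.1 fun s _ => abs_nonneg _
    gcongr
  have hlim : Tendsto (fun ε : ℝ => ((√(K + ε + 2 * (ε * M)) + ((∫ s in 0..t, g s) + ε))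
      * Real.exp (a * t)) ^ 2) (𝓝[>] 0)
      (𝓝 (((√(K + 0 + 2 * (0 * M)) + ((∫ s in 0..t, g s) + 0)) * Real.exp (a * t)) ^ 2)) :=
    ((by fun_prop : Continuous fun ε : ℝ => ((√(K + ε + 2 * (ε * M))
      + ((∫ s in 0..t, g s) + ε)) * Real.exp (a * t)) ^ 2).tendsto 0).mono_left nhdsWithin_le_nhds
  simp only [add_zero, zero_mul, mul_zero] at hlim
  refine ge_of_tendsto hlim ?_
  filter_upwards [self_mem_nhdsWithin] with ε hε using key ε hε

end Gronwall

/-! ### The delayed equation: energy identity and estimate -/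

section Delay

variable {S : ℝ → L2 →L[ℝ] L2} {lam0 lam : Linf} {τ T : ℝ} {u₀ f u : ℝ → L2}

/-- The right-hand side of the equation, with the delay term moved into the source. -/
def delaySource (lam : Linf) (τ T : ℝ) (f u : ℝ → L2) (s : ℝ) : L2 :=
  (Ioc 0 T).indicator f s - mulOp lam (u (s - τ))

theorem locallyIntegrable_delaySource (hf : IntegrableOn f (Ioc 0 T)) (hu : Continuous u) :
    LocallyIntegrable (delaySource lam τ T f u) volume :=
  (hf.integrable_indicator measurableSet_Ioc).locallyIntegrable.sub
    (by fun_prop : Continuous fun s => mulOp lam (u (s - τ))).locallyIntegrable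

theorem IsMildSolution.eq_duhamel (hS : IsC0Semigroup S) (hτ : 0 < τ)
    (h : IsMildSolution S lam τ T u₀ f u) (hf : IntegrableOn f (Ioc 0 T)) (hu : Continuous u)
    {t : ℝ} (ht : t ∈ Icc 0 T) :
    u t = S t (u 0) + duhamel S (delaySource lam τ T f u) t := by
  have i1 := hS.intervalIntegrable_duhamel
    (hf.integrable_indicator measurableSet_Ioc).locallyIntegrable ht.1
  have i2 := hS.intervalIntegrable_duhamel
    (by fun_prop : Continuous fun s => mulOp lam (u (s - τ))).locallyIntegrable ht.1
  have e : ∫ s in 0..t, S (t - s) ((Ioc 0 T).indicator f s) = ∫ s in 0..t, S (t - s) (f s) := by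
    refine intervalIntegral.integral_congr_ae (Eventually.of_forall fun s hs => ?_)
    rw [uIoc_of_le ht.1] at hs
    rw [indicator_of_mem (show s ∈ Ioc 0 T from ⟨hs.1, hs.2.trans ht.2⟩)]
  rw [duhamel_eq S _ ht.1]
  simp only [delaySource, map_sub]
  rw [intervalIntegral.integral_sub i1 i2, e, h.formula t ht,
    h.history 0 ⟨by linarith, le_rfl⟩]
  simp only [mulOp_apply]
  abel

theorem intervalIntegrable_inner_source (hf : IntegrableOn f (Ioc 0 T)) (hu : Continuous u)
    {t : ℝ} (ht : t ∈ Icc 0 T) : IntervalIntegrable (fun s => inner ℝ (f s) (u s)) volume 0 t := by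
  refine (intervalIntegrable_inner
    (hf.integrable_indicator measurableSet_Ioc).locallyIntegrable hu 0 t).congr fun s hs => ?_
  rw [uIoc_of_le ht.1] at hs
  rw [indicator_of_mem (show s ∈ Ioc 0 T from ⟨hs.1, hs.2.trans ht.2⟩)]

theorem integral_inner_delaySource (hf : IntegrableOn f (Ioc 0 T)) (hu : Continuous u)
    {t : ℝ} (ht : t ∈ Icc 0 T) :
    ∫ s in 0..t, inner ℝ (delaySource lam τ T f u s) (u s)
      = (∫ s in 0..t, inner ℝ (f s) (u s))
        - ∫ s in 0..t, inner ℝ (mulOp lam (u (s - τ))) (u s) := by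
  have i2 : IntervalIntegrable (fun s => inner ℝ (mulOp lam (u (s - τ))) (u s)) volume 0 t :=
    (by fun_prop : Continuous fun s =>
      (inner ℝ (mulOp lam (u (s - τ))) (u s) : ℝ)).intervalIntegrable 0 t
  rw [← intervalIntegral.integral_sub (intervalIntegrable_inner_source hf hu ht) i2]
  refine intervalIntegral.integral_congr_ae (Eventually.of_forall fun s hs => ?_)
  rw [uIoc_of_le ht.1] at hs
  rw [delaySource, indicator_of_mem (show s ∈ Ioc 0 T from ⟨hs.1, hs.2.trans ht.2⟩),
    inner_sub_left]

/-- With the delay term counted as source, u solves an undelayed problem on [0, t], and the endpoint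
identity is applied at time t. -/
theorem IsMildSolution.memL2H1_and_energy (hS : IsKdVBSemigroup lam0 S) (hτ : 0 < τ)
    (h : IsMildSolution S lam τ T u₀ f u) (hf : IntegrableOn f (Ioc 0 T)) (hu : Continuous u)
    {t : ℝ} (ht : t ∈ Icc 0 T) :
    MemL2H1 t u ∧ ‖u t‖ ^ 2 + 2 * (∫ s in 0..t, ‖weakDeriv (u s)‖ ^ 2)
        + 2 * (∫ s in 0..t, inner ℝ (mulOp lam0 (u s)) (u s))
        + 2 * (∫ s in 0..t, inner ℝ (mulOp lam (u (s - τ))) (u s))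
      = ‖u 0‖ ^ 2 + 2 * ∫ s in 0..t, inner ℝ (f s) (u s) := by
  obtain ⟨h1, h2⟩ := energy_identity_endpoint hS ht.1
    (locallyIntegrable_delaySource (lam := lam) (τ := τ) hf hu) hu
    (fun r hr => h.eq_duhamel hS.toIsC0Semigroup hτ hf hu ⟨hr.1, hr.2.trans ht.2⟩)
  refine ⟨h1, ?_⟩
  rw [integral_inner_delaySource hf hu ht] at h2
  linarith

/-- The energy inequality, with the delay term estimated by the history. -/
theorem IsMildSolution.energy_le (hS : IsKdVBSemigroup lam0 S) (hτ : 0 < τ)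
    (h : IsMildSolution S lam τ T u₀ f u) (hf : IntegrableOn f (Ioc 0 T)) (hu : Continuous u)
    {t : ℝ} (ht : t ∈ Icc 0 T) :
    ‖u t‖ ^ 2 + 2 * (∫ s in 0..t, ‖weakDeriv (u s)‖ ^ 2)
      ≤ (‖u 0‖ ^ 2 + ‖lam‖ * ∫ s in (-τ)..0, ‖u s‖ ^ 2)
        + 2 * (‖lam‖ + ‖lam0‖) * (∫ s in 0..t, ‖u s‖ ^ 2) + 2 * ∫ s in 0..t, ‖f s‖ * ‖u s‖ := by
  have hen := (h.memL2H1_and_energy hS hτ hf hu ht).2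
  have hsq : ∀ a b, IntervalIntegrable (fun s => ‖u s‖ ^ 2) volume a b := fun a b =>
    (by fun_prop : Continuous fun s => ‖u s‖ ^ 2).intervalIntegrable a b
  have hsq' : IntervalIntegrable (fun s => ‖u (s - τ)‖ ^ 2) volume 0 t :=
    (by fun_prop : Continuous fun s => ‖u (s - τ)‖ ^ 2).intervalIntegrable 0 t
  have hfi : IntervalIntegrable f volume 0 t :=
    (intervalIntegrable_iff_integrableOn_Ioc_of_le ht.1).2
      (hf.mono_set (Ioc_subset_Ioc_right ht.2))
  have e1 : |∫ s in 0..t, inner ℝ (mulOp lam0 (u s)) (u s)| ≤ ‖lam0‖ * ∫ s in 0..t, ‖u s‖ ^ 2 := by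
    rw [← intervalIntegral.integral_const_mul, ← Real.norm_eq_abs]
    refine intervalIntegral.norm_integral_le_of_norm_le ht.1 (Eventually.of_forall fun s _ => ?_)
      ((hsq 0 t).const_mul _)
    exact (abs_inner_mulOp_le lam0 (u s) (u s)).trans (le_of_eq (by ring))
  have e2 : |∫ s in 0..t, inner ℝ (f s) (u s)| ≤ ∫ s in 0..t, ‖f s‖ * ‖u s‖ := by
    rw [← Real.norm_eq_abs]
    refine intervalIntegral.norm_integral_le_of_norm_le ht.1 (Eventually.of_forall fun s _ => ?_)
      (hfi.norm.mul_continuousOn hu.norm.continuousOn)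
    exact norm_inner_le_norm _ _
  -- Young's inequality, 2‖u(s−τ)‖‖u(s)‖ ≤ ‖u(s−τ)‖² + ‖u(s)‖².
  have e3 : |∫ s in 0..t, inner ℝ (mulOp lam (u (s - τ))) (u s)|
      ≤ ‖lam‖ / 2 * ((∫ s in 0..t, ‖u (s - τ)‖ ^ 2) + ∫ s in 0..t, ‖u s‖ ^ 2) := by
    rw [← intervalIntegral.integral_add hsq' (hsq 0 t), ← intervalIntegral.integral_const_mul,
      ← Real.norm_eq_abs]
    refine intervalIntegral.norm_integral_le_of_norm_le ht.1 (Eventually.of_forall fun s _ => ?_)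
      ((hsq'.add (hsq 0 t)).const_mul _)
    refine (abs_inner_mulOp_le lam (u (s - τ)) (u s)).trans ?_
    nlinarith [mul_nonneg (norm_nonneg lam) (sq_nonneg (‖u (s - τ)‖ - ‖u s‖))]
  -- The shift turns the integral into one over [−τ, t − τ], which is contained in [−τ, t].
  have e4 : ∫ s in 0..t, ‖u (s - τ)‖ ^ 2
      ≤ (∫ s in (-τ)..0, ‖u s‖ ^ 2) + ∫ s in 0..t, ‖u s‖ ^ 2 := by
    rw [intervalIntegral.integral_comp_sub_right (fun s => ‖u s‖ ^ 2) τ, zero_sub,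
      intervalIntegral.integral_add_adjacent_intervals (hsq _ _) (hsq _ _)]
    exact intervalIntegral.integral_mono_interval le_rfl (by linarith [ht.1]) (by linarith)
      (Eventually.of_forall fun s => sq_nonneg _) (hsq _ _)
  have e5 := mul_le_mul_of_nonneg_left e4 (norm_nonneg lam)
  linarith [(abs_le.1 e1).1, (abs_le.1 e2).2, (abs_le.1 e3).1]

/-- Since e^{2‖λ‖T} ≥ 1, the two square roots in `constC` multiply to at least √3, and 1 + 1/√2 ≤
1.71 < 1.73 ≤ √3. -/
theorem one_add_sqrt_half_le (lam0 lam : Linf) (hT : 0 ≤ T) :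
    (1 + √(1 / 2)) * Real.exp ((‖lam‖ + ‖lam0‖) * T) ≤ constC lam0 lam T := by
  rw [constC]
  gcongr
  have h1 : √(1 / 2 : ℝ) ≤ 0.71 := Real.sqrt_le_left (by norm_num) |>.2 (by norm_num)
  have h2 : (1.73 : ℝ) ≤ √3 := Real.le_sqrt_of_sq_le (by norm_num)
  have h3 : √3 ≤ √(3 / 2) * √(1 + Real.exp (2 * ‖lam‖ * T)) := by
    rw [← Real.sqrt_mul (by norm_num)]
    apply Real.sqrt_le_sqrt
    have : 1 ≤ Real.exp (2 * ‖lam‖ * T) := Real.one_le_exp (by positivity)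
    linarith
  linarith

/-- `gronwall_sq` bounds the whole right side of the energy inequality, hence also the dissipation:
‖u(t)‖² + 2∫₀ᵗ‖u_x‖² ≤ X². So the supremum is at most X and the derivative norm at most X/√2. -/
theorem IsMildSolution.normB_le (hS : IsKdVBSemigroup lam0 S) (hτ : 0 < τ) (hT : 0 < T)
    (h : IsMildSolution S lam τ T u₀ f u) (hf : IntegrableOn f (Ioc 0 T)) (hu : Continuous u) :
    normB T u ≤ constC lam0 lam T * (‖u 0‖ + (∫ t in 0..T, ‖f t‖)
      + (‖lam‖ * √τ + √‖lam‖) * √(∫ s in (-τ)..0, ‖u s‖ ^ 2)) := by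
  set m := ∫ s in (-τ)..0, ‖u s‖ ^ 2
  set N := ‖u 0‖ + (∫ t in 0..T, ‖f t‖) + (‖lam‖ * √τ + √‖lam‖) * √m
  set a := ‖lam‖ + ‖lam0‖ with ha
  have ha0 : 0 ≤ a := by positivity
  have hm : 0 ≤ m := intervalIntegral.integral_nonneg (by linarith) fun s _ => sq_nonneg _
  have hf0 : 0 ≤ ∫ t in 0..T, ‖f t‖ :=
    intervalIntegral.integral_nonneg hT.le fun s _ => norm_nonneg _
  have hN : 0 ≤ N := by positivity
  have hD : ∀ t ∈ Icc 0 T, 0 ≤ ∫ s in 0..t, ‖weakDeriv (u s)‖ ^ 2 := fun t ht =>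
    intervalIntegral.integral_nonneg ht.1 fun s _ => sq_nonneg _
  have hK : 0 ≤ ‖u 0‖ ^ 2 + ‖lam‖ * m := by positivity
  have hsqrt : √(‖u 0‖ ^ 2 + ‖lam‖ * m) ≤ ‖u 0‖ + √‖lam‖ * √m := by
    refine Real.sqrt_le_left (by positivity) |>.2 ?_
    have h1 : (√‖lam‖ * √m) ^ 2 = ‖lam‖ * m := by
      rw [mul_pow, Real.sq_sqrt (norm_nonneg _), Real.sq_sqrt hm]
    nlinarith [mul_nonneg (norm_nonneg (u 0)) (mul_nonneg (Real.sqrt_nonneg ‖lam‖)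
      (Real.sqrt_nonneg m))]
  have hmain : ∀ t ∈ Icc 0 T, ‖u t‖ ^ 2 + 2 * (∫ s in 0..t, ‖weakDeriv (u s)‖ ^ 2)
      ≤ (N * Real.exp (a * T)) ^ 2 := by
    intro t ht
    refine (h.energy_le hS hτ hf hu ht).trans ?_
    refine (gronwall_sq (y := fun s => ‖u s‖) (g := fun s => ‖f s‖) hu.norm
      hf.norm (fun _ => norm_nonneg _) hK ha0 (fun r hr => ?_) ht).trans ?_
    · linarith [h.energy_le hS hτ hf hu hr, hD r hr]
    · have h1 : ∫ s in 0..t, ‖f s‖ ≤ ∫ s in 0..T, ‖f s‖ :=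
        intervalIntegral.integral_mono_interval le_rfl ht.1 ht.2
          (Eventually.of_forall fun s => norm_nonneg _)
          ((intervalIntegrable_iff_integrableOn_Ioc_of_le hT.le).2 hf.norm)
      have h2 : 0 ≤ ∫ s in 0..t, ‖f s‖ :=
        intervalIntegral.integral_nonneg ht.1 fun s _ => norm_nonneg _
      -- The term with √τ only enlarges N; the Gronwall bound already holds without it.
      have h3 : 0 ≤ ‖lam‖ * √τ * √m := by positivity
      have h4 : √(‖u 0‖ ^ 2 + ‖lam‖ * m) + ∫ s in 0..t, ‖f s‖ ≤ N := by
        simp only [N]; linarith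
      gcongr
      exact ht.2
  set X := N * Real.exp (a * T)
  have hX : 0 ≤ X := by positivity
  have hsup : sSup ((fun t => ‖u t‖) '' Icc 0 T) ≤ X := by
    refine csSup_le ((nonempty_Icc.2 hT.le).image _) ?_
    rintro _ ⟨t, ht, rfl⟩
    refine abs_le_of_sq_le_sq' ?_ hX |>.2
    linarith [hmain t ht, hD t ht]
  have hder : √(∫ t in 0..T, ‖weakDeriv (u t)‖ ^ 2) ≤ √(1 / 2) * X := by
    rw [← Real.sqrt_sq hX, ← Real.sqrt_mul (by norm_num)]
    apply Real.sqrt_le_sqrt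
    linarith [hmain T (right_mem_Icc.2 hT.le), sq_nonneg ‖u T‖]
  calc normB T u ≤ X + √(1 / 2) * X := add_le_add hsup hder
    _ = (1 + √(1 / 2)) * Real.exp (a * T) * N := by simp only [X]; ring
    _ ≤ constC lam0 lam T * N :=
      mul_le_mul_of_nonneg_right (one_add_sqrt_half_le lam0 lam hT.le) hN

end Delay

end KdVBurgers

end

theorem proposition3p2 (τ T : ℝ) (hτ : 0 < τ) (hT : 0 < T) (lam0 lam : KdVBurgers.Linf)
    (u₀ f : ℝ → KdVBurgers.L2) (hu₀ : ContinuousOn u₀ (Icc (-τ) 0))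
    (hf : IntegrableOn f (Ioo 0 T)) :
    (∃ S : ℝ → KdVBurgers.L2 →L[ℝ] KdVBurgers.L2, KdVBurgers.IsKdVBSemigroup lam0 S) ∧
    ∀ S : ℝ → KdVBurgers.L2 →L[ℝ] KdVBurgers.L2, KdVBurgers.IsKdVBSemigroup lam0 S →
      ∃ u : ℝ → KdVBurgers.L2,
        KdVBurgers.IsMildSolution S lam τ T u₀ f u ∧
        (∀ v : ℝ → KdVBurgers.L2,
          KdVBurgers.IsMildSolution S lam τ T u₀ f v → EqOn v u (Icc (-τ) T)) ∧
        KdVBurgers.MemB T u ∧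
        KdVBurgers.normB T u ≤ KdVBurgers.constC lam0 lam T *
          (‖u 0‖ + (∫ t in 0..T, ‖f t‖)
            + (‖lam‖ * √τ + √‖lam‖) * √(∫ s in (-τ)..0, ‖u s‖ ^ 2)) ∧
        ∀ t ∈ Icc 0 T,
          1 / 2 * ‖u t‖ ^ 2
              + (∫ s in 0..t, ‖KdVBurgers.weakDeriv (u s)‖ ^ 2)
              + (∫ s in 0..t, ∫ x : ℝ, lam0 x * u s x ^ 2)
              + (∫ s in 0..t, ∫ x : ℝ, lam x * u (s - τ) x * u s x)
            = 1 / 2 * ‖u 0‖ ^ 2 + ∫ s in 0..t, ∫ x : ℝ, f s x * u s x := by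
  refine ⟨KdVBurgers.exists_isKdVBSemigroup lam0, fun S hS => ?_⟩
  have hC0 := hS.toIsC0Semigroup
  have hf' : IntegrableOn f (Ioc 0 T) := (integrableOn_Ioc_iff_integrableOn_Ioo).2 hf
  -- This solution is continuous on all of ℝ, as the energy lemmas require; any other solution is
  -- compared with it only on [−τ, T].
  obtain ⟨u, hu, hmild⟩ := KdVBurgers.exists_isMildSolution hC0 lam hτ T hu₀ hf
  refine ⟨u, hmild, fun v hv => hmild.eqOn hτ hv,
    ⟨hu.continuousOn, (hmild.memL2H1_and_energy hS hτ hf' hu (right_mem_Icc.2 hT.le)).1⟩,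
    hmild.normB_le hS hτ hT hf' hu, fun t ht => ?_⟩
  have h := (hmild.memL2H1_and_energy hS hτ hf' hu ht).2
  simp only [KdVBurgers.inner_mulOp] at h
  simp only [KdVBurgers.inner_L2, mul_assoc, ← sq] at h
  simp only [mul_assoc]
  linarith
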